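/- Let $W\in\mathbb R^{m\times r}$, $q\in\mathbb R^r$, $c\in\mathbb R^n$, and let $Z\subseteq\mathbb R^n$ be a polyhedron. A scenario is a pair $\xi=(h,T)$ with $h\in\mathbb R^m$, $T\in\mathbb R^{m\times n}$ (with the Euclidean norm on pairs). Put $$Q(z,\xi)=\min\{q^\top y : Wy=h-Tz,\ y\ge 0\},\qquad G(z,\xi)=c^\top z+Q(z,\xi).$$ Let $\mathcal T\subseteq\mathbb R^{m\times n}$ be a set of admissible technology matrices that is either compact or equal to $\mathbb R^{m\times n}$; let $S=\mathbb R^m\times\mathcal T$ be the set of admissible scenarios. Assume that $Z$ is non-empty and bounded, that $U=\{u\in\mathbb R^m: W^\top u\le q\}$ is non-empty and bounded, and that for every $\xi\in S$ the one-scenario problem $\min_{z\in Z}G(z,\xi)$ has a unique optimal solution, denoted $z_D^*(\xi)$. Then there is a constant $K\ge 0$, depending only on $c,W,q,Z,\mathcal T$, with the following property. Let $\mathcal X\subseteq\mathbb R^s$, let $(X,\xi)$ be a random element of $\mathcal X\times S$ with $\xi$ integrable, and let $(X_1,\xi_1),(X_2,\xi_2),\dots$ be i.i.d. copies of $(X,\xi)$.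 Let $\Theta\subseteq\mathbb R^p$ be non-empty and let $\Psi:\Theta\times\mathcal X\to S$ be a forecast function, where either (a) $\Theta$ is compact and $\Psi$ is continuous in each of its two arguments, or (b) $\Theta$ is finite and $\Psi(\theta,\cdot)$ is measurable for every $\theta$. For every $x\in\mathcal X$ let $\xi^*_x\in S$ depend measurably on $x$ and be an optimal scenario for the conditional problem, that is, for almost every $x$ (with respect to the law of $X$) $z_D^*(\xi^*_x)$ is an optimal solution of $\min_{z\in Z}\mathbb E[G(z,\xi)\mid X=x]$. Suppose that there are $\delta\ge 0$ and $\hat\theta\in\Theta$ with $\|\Psi(\hat\theta,x)-\xi^*_x\|\le\delta$ for all $x\in\mathcal X$. For $N\ge1$ let $\theta_N^*$ be an optimal solution of $$\min_{\theta\in\Theta}\ \frac1N\sum_{i=1}^N G\bigl(z_D^*(\Psi(\theta,X_i)),\xi_i\bigr).$$ Let $\Pi$ be the set of measurable maps $\pi:\mathcal X\to Z$ and $\mathcal P(\pi)=\mathbb E[G(\pi(X),\xi)]$. Then the minimum of $\mathcal P$ over $\Pi$ is attained, and, with probability 1, $\mathcal P\bigl(z_D^*(\Psi(\theta_N^*,\cdot))\bigr)$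 (the expectation being over $(X,\xi)$ only, with $\theta_N^*$ held fixed) converges as $N\to\infty$ to a limit that does not depend on the realization of the data and satisfies $$\lim_{N\to\infty}\mathcal P\bigl(z_D^*(\Psi(\theta_N^*,\cdot))\bigr)-\min_{\pi\in\Pi}\mathcal P(\pi)\le K\delta .$$ -/

import Mathlib

open MeasureTheory ProbabilityTheory Filter Topology Matrix

namespace TwoStage

/-- Euclidean space of dimension `n`. -/
abbrev E (n : ℕ) : Type := EuclideanSpace ℝ (Fin n)

/-- A scenario `ξ = (h, T)`, with `h` a vector in `ℝᵐ` and `T` a real `m × n` matrix, as a vector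
of the Euclidean space of dimension `m + m * n`: the norm is
`(∑ i, h i ^ 2 + ∑ i j, T i j ^ 2) ^ (1/2)`. -/
abbrev Scenario (m n : ℕ) : Type := EuclideanSpace ℝ (Fin m ⊕ Fin m × Fin n)

/-- The right-hand side `h` of a scenario `(h, T)`. -/
def rhs {m n : ℕ} (ξ : Scenario m n) : Fin m → ℝ := fun i => ξ (Sum.inl i)

/-- The technology matrix `T` of a scenario `(h, T)`. -/
def tech {m n : ℕ} (ξ : Scenario m n) : Matrix (Fin m) (Fin n) ℝ :=
  Matrix.of fun i j => ξ (Sum.inr (i, j))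

/-- The deterministic data of a two-stage program with fixed recourse and fixed costs: feasible set
`Z`, first-stage cost `f`, recourse matrix `W` and second-stage cost vector `q`. -/
structure Program (n m r : ℕ) where
  /-- first-stage feasible set -/
  Z : Set (E n)
  /-- first-stage cost -/
  f : E n → ℝ
  /-- recourse matrix -/
  W : Matrix (Fin m) (Fin r) ℝ
  /-- second-stage costs -/
  q : Fin r → ℝ

/-- `Z` is a polyhedron: the solution set of finitely many linear inequalities. -/
def IsPolyhedral {n : ℕ} (Z : Set (E n)) : Prop :=
  ∃ (k : ℕ) (A : Matrix (Fin k) (Fin n) ℝ) (b : Fin k → ℝ),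
    Z = {z | ∀ i, (A *ᵥ z.ofLp) i ≤ b i}

namespace Program

variable {n m r : ℕ} (P : Program n m r)

/-- The second-stage value `Q(z, ξ) = min {qᵀy : W y = h - T z, y ≥ 0}`. -/
noncomputable def recourse (z : E n) (ξ : Scenario m n) : ℝ :=
  sInf {v | ∃ y : Fin r → ℝ, (∀ j, 0 ≤ y j) ∧ P.W *ᵥ y = rhs ξ - tech ξ *ᵥ z.ofLp ∧
    v = P.q ⬝ᵥ y}

/-- The total cost `G(z, ξ) = f(z) + Q(z, ξ)`. -/
noncomputable def G (z : E n) (ξ : Scenario m n) : ℝ := P.f z + P.recourse z ξ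

/-- The dual feasible set `U = {u : Wᵀu ≤ q}` of the second stage. -/
def dualFeasible : Set (E m) := {u | ∀ j, (P.Wᵀ *ᵥ u.ofLp) j ≤ P.q j}

/-- The set of optimal solutions of the one-scenario problem `min_{z ∈ Z} G(z, ξ)`. -/
def oneScenarioArgmin (ξ : Scenario m n) : Set (E n) :=
  {z | z ∈ P.Z ∧ ∀ w ∈ P.Z, P.G z ξ ≤ P.G w ξ}

/-- The set of optimal solutions of `min_{z ∈ Z} E[G(z, ξ)]`, where `ξ` has distribution `κ`. -/
def expectedArgmin (κ : Measure (Scenario m n)) : Set (E n) :=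
  {z | z ∈ P.Z ∧ ∀ w ∈ P.Z, ∫ ξ, P.G z ξ ∂κ ≤ ∫ ξ, P.G w ξ ∂κ}

/-- `ξs` is an optimal scenario for the distribution `κ`: the one-scenario problem at `ξs` has
an optimal solution, and solving it solves the stochastic problem. -/
def IsOptimalScenario (κ : Measure (Scenario m n)) (ξs : Scenario m n) : Prop :=
  (P.oneScenarioArgmin ξs).Nonempty ∧ P.oneScenarioArgmin ξs ⊆ P.expectedArgmin κ

open Classical in
/-- The optimal solution `z_D^*(ξ)` of the one-scenario problem
(an arbitrary one if it is not unique, and `0` if there is none). -/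
noncomputable def zD (ξ : Scenario m n) : E n :=
  if h : (P.oneScenarioArgmin ξ).Nonempty then h.some else 0

variable {s : ℕ} {𝒳 : Set (E s)}

/-- The set `Π` of policies: (measurable) maps from `𝒳` to `Z`. -/
def policies (𝒳 : Set (E s)) : Set (𝒳 → E n) :=
  {π | Measurable π ∧ ∀ x, π x ∈ P.Z}

/-- The performance `E[G(π(X), ξ)]` of a policy, where `(X, ξ)` has distribution `ν`. -/
noncomputable def performance (ν : Measure (𝒳 × Scenario m n)) (π : 𝒳 → E n) : ℝ :=
  ∫ p, P.G (π p.1) p.2 ∂ν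

/-- The empirical cost `(1/N) ∑_{i < N} G(z_D^*(Ψ(θ, x_i)), ξ_i)` of the parameter `θ`. -/
noncomputable def empiricalCost {p : ℕ} (Ψ : E p → 𝒳 → Scenario m n)
    (data : ℕ → 𝒳 × Scenario m n) (N : ℕ) (θ : E p) : ℝ :=
  (1 / (N : ℝ)) * ∑ i ∈ Finset.range N, P.G (P.zD (Ψ θ (data i).1)) (data i).2

/-- The set of optimal solutions `θ` in `Θ` of the bilevel learning model with sample size `N`. -/
def learningArgmin {p : ℕ} (Θ : Set (E p)) (Ψ : E p → 𝒳 → Scenario m n)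
    (data : ℕ → 𝒳 × Scenario m n) (N : ℕ) : Set (E p) :=
  {θ | θ ∈ Θ ∧ ∀ η ∈ Θ, P.empiricalCost Ψ data N θ ≤ P.empiricalCost Ψ data N η}

end Program

end TwoStage

/-! The heart of the matter is a Lipschitz bound on admissible scenarios for the one-scenario
solution map `zD`, with a constant that ignores all probabilistic data.

For compact `𝒯` this is `exists_lipschitz_solution`, proved by contradiction. Take pairs of
solutions whose distance dominates the perturbation of the scenario. Along an ultrafilter the
technology matrices, the dual vectors, the normalized differences and the active sets of the
optimality conditions stabilize. The right-hand sides may be unbounded, so no limit of them is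
taken; instead, differences of primal points with fixed active sets form a closed polyhedral cone,
which contains the limiting difference. Rescaling a representation of it gives two distinct
solutions of a single scenario, against uniqueness. Closedness of such cones and linear programming
duality come from finitely generated cones and Farkas' lemma.

For unrestricted `𝒯`, uniqueness is so strong that `zD` is constant (`zD_eq_of_forall_unique`):
either the recourse vanishes, or a rank-one matrix makes the recourse cancel the first-stage cost,
so that all of `Z` is optimal and must be a single point.

The recourse is a maximum of linear functionals over a bounded set, so the cost is Lipschitz in the
decision, uniformly for bounded `𝒯`, and grows linearly in the scenario. Continuity of `zD` then
allows a strong law in the Banach space `C(Θ, ℝ)`: empirical costs converge uniformly, and the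
performance of the learned parameters tends to its minimum over `Θ`. That minimum is at most the
performance of the parameter `δ`-close to the optimal scenarios, hence at most `K * δ` above the
optimum, which is attained by `zD` of the optimal scenarios, by disintegration. -/

namespace TwoStage

/-! ### Finitely generated cones, Farkas' lemma and linear programming duality. -/

section Cones

variable {ι κ ι' V : Type*} [Fintype ι] [Fintype κ] [Fintype ι']

/-- A point of a finitely generated cone is a nonnegative combination of linearly independent
generators. -/
theorem exists_nonneg_injective_support [AddCommGroup V] [Module ℝ V] (L : (ι → ℝ) →ₗ[ℝ] V)
    (x : ι → ℝ) (hx : ∀ i, 0 ≤ x i) :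
    ∃ y : ι → ℝ, (∀ i, 0 ≤ y i) ∧ L y = L x ∧
      ∀ k : ι → ℝ, (∀ i, y i = 0 → k i = 0) → L k = 0 → k = 0 := by
  classical
  induction hN : (Finset.univ.filter fun i => x i ≠ 0).card using Nat.strong_induction_on
    generalizing x with
  | _ N ih =>
  by_cases hinj : ∀ k : ι → ℝ, (∀ i, x i = 0 → k i = 0) → L k = 0 → k = 0
  · exact ⟨x, hx, rfl, hinj⟩
  push Not at hinj
  obtain ⟨k₀, hk₀, hLk₀, hk₀ne⟩ := hinj
  -- A kernel vector may be negated, so it can be assumed to have a positive entry.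
  obtain ⟨k, hk, hLk, i₀, hi₀⟩ : ∃ k : ι → ℝ, (∀ i, x i = 0 → k i = 0) ∧ L k = 0 ∧
      ∃ i, 0 < k i := by
    obtain ⟨i, hi⟩ := Function.ne_iff.1 hk₀ne
    rcases lt_or_gt_of_ne hi with h | h
    · exact ⟨-k₀, fun i h => by simp [hk₀ i h], by simp [hLk₀], i, by simpa using h⟩
    · exact ⟨k₀, hk₀, hLk₀, i, h⟩
  -- Ratio test: moving along `-k` by the smallest ratio annihilates coordinate `j` and keeps all
  -- others nonnegative.
  obtain ⟨j, hj, hmin⟩ := Finset.exists_min_image (Finset.univ.filter fun i => 0 < k i)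
    (fun i => x i / k i) ⟨i₀, by simpa using hi₀⟩
  simp only [Finset.mem_filter, Finset.mem_univ, true_and] at hj hmin
  have ht : 0 ≤ x j / k j := div_nonneg (hx j) hj.le
  have hnn : ∀ i, 0 ≤ (x - (x j / k j) • k) i := by
    intro i
    simp only [Pi.sub_apply, Pi.smul_apply, smul_eq_mul, sub_nonneg]
    rcases le_or_gt (k i) 0 with h | h
    · exact (mul_nonpos_of_nonneg_of_nonpos ht h).trans (hx i)
    · exact (le_div_iff₀ h).1 (hmin i h)
  have hlt : (Finset.univ.filter fun i => (x - (x j / k j) • k) i ≠ 0).card < N := by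
    rw [← hN]
    apply Finset.card_lt_card
    refine Finset.ssubset_iff_of_subset ?_ |>.2 ⟨j, ?_, ?_⟩
    · intro i
      simp only [Finset.mem_filter, Finset.mem_univ, true_and]
      intro h h0
      exact h (by simp [h0, hk i h0])
    · simp only [Finset.mem_filter, Finset.mem_univ, true_and]
      intro h
      exact hj.ne' (hk j h)
    · simp [hj.ne']
  obtain ⟨y, hy, hLy, hyi⟩ := ih _ hlt _ hnn rfl
  exact ⟨y, hy, by rw [hLy]; simp [hLk], hyi⟩

variable [NormedAddCommGroup V] [NormedSpace ℝ V]

/-- Finitely generated cones are closed. -/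
theorem isClosed_image_nonneg (L : (ι → ℝ) →ₗ[ℝ] V) :
    IsClosed (L '' {x | ∀ i, 0 ≤ x i}) := by
  classical
  -- The cone is a finite union of images of coordinate orthants on which `L` is injective, hence a
  -- closed embedding.
  let F (s : Finset ι) : Submodule ℝ (ι → ℝ) :=
    { carrier := {x | ∀ i ∉ s, x i = 0}
      add_mem' := fun {a b} ha hb i hi => by simp [ha i hi, hb i hi]
      zero_mem' := fun i _ => rfl
      smul_mem' := fun c x hx i hi => by simp [hx i hi] }
  have key : L '' {x | ∀ i, 0 ≤ x i} = ⋃ s ∈ {s : Finset ι | Function.Injective (L.domRestrict (F s))},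
      (L.domRestrict (F s)) '' {x | ∀ i, 0 ≤ x.1 i} := by
    ext v
    simp only [Set.mem_image, Set.mem_iUnion, Set.mem_ofPred_eq, exists_prop]
    constructor
    · rintro ⟨x, hx, rfl⟩
      obtain ⟨y, hy, hLy, hinj⟩ := exists_nonneg_injective_support L x hx
      refine ⟨Finset.univ.filter fun i => y i ≠ 0, ?_, ⟨y, ?_⟩, hy, hLy⟩
      · rw [injective_iff_map_eq_zero]
        rintro ⟨k, hk⟩ h
        ext1
        exact hinj k (fun i hi => hk i (by simp [hi])) h
      · intro i hi
        simpa using hi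
    · rintro ⟨s, -, x, hx, rfl⟩
      exact ⟨x.1, hx, rfl⟩
  rw [key]
  refine Set.Finite.isClosed_biUnion (Set.toFinite _) fun s hs => ?_
  refine (LinearMap.isClosedEmbedding_of_injective (LinearMap.ker_eq_bot.2 hs)).isClosedMap _ ?_
  have : {x : F s | ∀ i, 0 ≤ x.1 i} = ⋂ i, {x : F s | 0 ≤ x.1 i} := by ext; simp
  rw [this]
  exact isClosed_iInter fun i => isClosed_le continuous_const
    ((continuous_apply i).comp continuous_subtype_val)

/-- Linear images of polyhedral cones are closed. -/
theorem isClosed_image_polyhedralCone (L : (κ → ℝ) →ₗ[ℝ] V) (M : (κ → ℝ) →ₗ[ℝ] (ι → ℝ)) :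
    IsClosed (L '' {x | ∀ i, 0 ≤ M x i}) := by
  -- Split `x` into positive and negative parts (`p₁`) and add slacks (`p₂`); the image becomes a
  -- slice of a finitely generated cone.
  let p₁ : (κ ⊕ κ ⊕ ι → ℝ) →ₗ[ℝ] (κ → ℝ) :=
    LinearMap.funLeft ℝ ℝ Sum.inl - LinearMap.funLeft ℝ ℝ (Sum.inr ∘ Sum.inl)
  let p₂ : (κ ⊕ κ ⊕ ι → ℝ) →ₗ[ℝ] (ι → ℝ) := LinearMap.funLeft ℝ ℝ (Sum.inr ∘ Sum.inr)
  let N : (κ ⊕ κ ⊕ ι → ℝ) →ₗ[ℝ] V × (ι → ℝ) := (L ∘ₗ p₁).prod (M ∘ₗ p₁ - p₂)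
  have key : L '' {x | ∀ i, 0 ≤ M x i} = (fun v => (v, (0 : ι → ℝ))) ⁻¹' (N '' {x | ∀ i, 0 ≤ x i}) := by
    ext v
    simp only [Set.mem_image, Set.mem_ofPred_eq, Set.mem_preimage]
    constructor
    · rintro ⟨x, hx, rfl⟩
      have h1 : p₁ (Sum.elim (fun i => max (x i) 0) (Sum.elim (fun i => max (-x i) 0) (M x))) = x := by
        ext i
        simp [p₁, LinearMap.funLeft_apply]
      have h2 : p₂ (Sum.elim (fun i => max (x i) 0) (Sum.elim (fun i => max (-x i) 0) (M x))) =
          M x := by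
        ext i
        simp [p₂, LinearMap.funLeft_apply]
      refine ⟨Sum.elim (fun i => max (x i) 0) (Sum.elim (fun i => max (-x i) 0) (M x)), ?_, ?_⟩
      · rintro (i | i | i)
        · exact le_max_right _ _
        · exact le_max_right _ _
        · exact hx i
      · simp [N, h1, h2]
    · rintro ⟨x, hx, hN⟩
      have h1 : L (p₁ x) = v := congrArg Prod.fst hN
      have h2 : M (p₁ x) - p₂ x = 0 := congrArg Prod.snd hN
      refine ⟨p₁ x, fun i => ?_, h1⟩
      rw [sub_eq_zero.1 h2]
      exact hx _
  rw [key]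
  exact (isClosed_image_nonneg N).preimage (by fun_prop)

/-- **Farkas' lemma**. -/
theorem farkas (A : Matrix ι κ ℝ) (c : κ → ℝ)
    (h : ∀ x, (∀ i, 0 ≤ (A *ᵥ x) i) → 0 ≤ c ⬝ᵥ x) :
    ∃ l : ι → ℝ, (∀ i, 0 ≤ l i) ∧ l ᵥ* A = c := by
  classical
  by_contra hc
  let L : (ι → ℝ) →ₗ[ℝ] (κ → ℝ) := A.vecMulLinear
  let C : ProperCone ℝ (κ → ℝ) :=
    { carrier := L '' {x | ∀ i, 0 ≤ x i}
      add_mem' := by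
        rintro _ _ ⟨a, ha, rfl⟩ ⟨b, hb, rfl⟩
        exact ⟨a + b, fun i => add_nonneg (ha i) (hb i), map_add _ _ _⟩
      zero_mem' := ⟨0, fun _ => le_rfl, map_zero _⟩
      smul_mem' := by
        rintro t _ ⟨a, ha, rfl⟩
        exact ⟨(t : ℝ) • a, fun i => mul_nonneg t.2 (ha i), map_smul _ _ _⟩
      isClosed' := isClosed_image_nonneg L }
  have hcC : c ∉ C := by
    rintro ⟨l, hl, hlc⟩
    exact hc ⟨l, hl, hlc⟩
  obtain ⟨f, hf, hfc⟩ := C.hyperplane_separation_point hcC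
  have hfx : ∀ v, f v = v ⬝ᵥ fun k => f (Pi.single k 1) := by
    intro v
    conv_lhs => rw [pi_eq_sum_univ' v, map_sum]
    simp [dotProduct]
  refine absurd (h (fun k => f (Pi.single k 1)) fun i => ?_) (by rw [← hfx]; exact not_le.2 hfc)
  have := hf (L (Pi.single i 1)) ⟨_, fun j => by
    by_cases hij : j = i
    · subst hij; simp
    · simp [hij], rfl⟩
  rw [hfx] at this
  simpa [L, Matrix.single_one_vecMul, Matrix.mulVec, Matrix.row] using this

/-- **Strong duality of linear programming**: an optimal solution of
`min {c x : A x ≥ b, B x = d}` admits a dual solution with the same value. -/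
theorem exists_dual_of_optimal (A : Matrix ι κ ℝ) (b : ι → ℝ) (B : Matrix ι' κ ℝ) (d : ι' → ℝ)
    (c x₀ : κ → ℝ) (hA : ∀ i, b i ≤ (A *ᵥ x₀) i) (hB : B *ᵥ x₀ = d)
    (hopt : ∀ x, (∀ i, b i ≤ (A *ᵥ x) i) → B *ᵥ x = d → c ⬝ᵥ x₀ ≤ c ⬝ᵥ x) :
    ∃ (l : ι → ℝ) (u : ι' → ℝ), (∀ i, 0 ≤ l i) ∧ l ᵥ* A + u ᵥ* B = c ∧
      l ⬝ᵥ b + u ⬝ᵥ d = c ⬝ᵥ x₀ := by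
  -- Homogenize with a variable `t ≥ 0`: `A w ≥ t b` and `B w = t d` (as two inequalities) imply `c
  -- w ≥ t (c x₀)`.
  let M : Matrix (ι ⊕ Unit ⊕ ι' ⊕ ι') (κ ⊕ Unit) ℝ :=
    Matrix.of (Sum.elim (fun i => Sum.elim (A i) fun _ => -b i)
      (Sum.elim (fun _ => Sum.elim 0 fun _ => 1)
        (Sum.elim (fun i => Sum.elim (B i) fun _ => -d i)
          (fun i => Sum.elim (-B i) fun _ => d i))))
  obtain ⟨l, hl, hlM⟩ := farkas M (Sum.elim c fun _ => -(c ⬝ᵥ x₀)) (by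
    intro x hx
    obtain ⟨w, t, rfl⟩ : ∃ (w : κ → ℝ) (t : ℝ), x = Sum.elim w fun _ => t :=
      ⟨x ∘ Sum.inl, x (Sum.inr ()), by ext (i | i) <;> rfl⟩
    have h1 : ∀ i, t * b i ≤ (A *ᵥ w) i := fun i => by
      have := hx (Sum.inl i)
      simp [M, mulVec, dotProduct] at this ⊢
      linarith
    have h2 : 0 ≤ t := by
      have := hx (Sum.inr (Sum.inl ()))
      simpa [M, mulVec, dotProduct] using this
    have h3 : B *ᵥ w = t • d := by
      ext i
      have e1 := hx (Sum.inr (Sum.inr (Sum.inl i)))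
      have e2 := hx (Sum.inr (Sum.inr (Sum.inr i)))
      simp [M, mulVec, dotProduct] at e1 e2 ⊢
      linarith
    have goal : 0 ≤ c ⬝ᵥ w - t * (c ⬝ᵥ x₀) := by
      -- If `t = 0`, then `w` is a recession direction and `x₀ + w` is feasible; otherwise `w / t`
      -- is.
      rcases h2.eq_or_lt with rfl | ht
      · have := hopt (x₀ + w) (fun i => by
          have := h1 i
          rw [mulVec_add, Pi.add_apply]
          linarith [hA i]) (by rw [mulVec_add, h3, hB]; simp)
        rw [dotProduct_add] at this
        linarith
      · have := hopt (t⁻¹ • w) (fun i => by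
          rw [mulVec_smul, Pi.smul_apply, smul_eq_mul, inv_mul_eq_div, le_div_iff₀ ht, mul_comm]
          exact h1 i) (by rw [mulVec_smul, h3, smul_smul, inv_mul_cancel₀ ht.ne', one_smul])
        rw [dotProduct_smul, smul_eq_mul, inv_mul_eq_div, le_div_iff₀ ht] at this
        linarith
    have : (Sum.elim c fun _ => -(c ⬝ᵥ x₀)) ⬝ᵥ (Sum.elim w fun _ : Unit => t) =
        c ⬝ᵥ w - t * (c ⬝ᵥ x₀) := by
      rw [sumElim_dotProduct_sumElim]
      simp [dotProduct_comm]
      ring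
    rwa [this])
  set l₁ : ι → ℝ := fun i => l (Sum.inl i) with hl₁
  set u : ι' → ℝ := fun i => l (Sum.inr (Sum.inr (Sum.inl i))) - l (Sum.inr (Sum.inr (Sum.inr i)))
    with hu
  have e1 : l₁ ᵥ* A + u ᵥ* B = c := by
    ext k
    have := congrFun hlM (Sum.inl k)
    simp [M, vecMul, dotProduct] at this
    simp [vecMul, dotProduct, ← this, hl₁, hu, sub_mul, Finset.sum_sub_distrib]
    ring
  -- The `t`-column gives equality up to the nonnegative multiplier of `t ≥ 0`; weak duality
  -- supplies the converse.
  have e2 : c ⬝ᵥ x₀ ≤ l₁ ⬝ᵥ b + u ⬝ᵥ d := by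
    have := congrFun hlM (Sum.inr ())
    simp [M, vecMul, dotProduct] at this
    have h0 := hl (Sum.inr (Sum.inl ()))
    simp only [dotProduct, hl₁, hu, sub_mul, Finset.sum_sub_distrib]
    linarith
  have e3 : l₁ ⬝ᵥ b + u ⬝ᵥ d ≤ c ⬝ᵥ x₀ := by
    have h1 : l₁ ⬝ᵥ b ≤ l₁ ⬝ᵥ A *ᵥ x₀ :=
      Finset.sum_le_sum fun i _ => mul_le_mul_of_nonneg_left (hA i) (hl _)
    rw [← e1, add_dotProduct, ← dotProduct_mulVec, ← dotProduct_mulVec, hB]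
    linarith
  exact ⟨l₁, u, fun i => hl _, e1, le_antisymm e3 e2⟩

end Cones

/-! ### The second-stage value function. -/

section SecondStage

variable {ι κ : Type*} [Fintype ι] [Fintype κ]

/-- The optimal value `min {qᵀy : W y = b, y ≥ 0}` as a function of the right-hand side `b`. -/
noncomputable def stageValue (W : Matrix ι κ ℝ) (q : κ → ℝ) (b : ι → ℝ) : ℝ :=
  sInf {v | ∃ y : κ → ℝ, (∀ j, 0 ≤ y j) ∧ W *ᵥ y = b ∧ v = q ⬝ᵥ y}

/-- Dual feasible points are bounded as functionals by `R`. -/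
def DualBound (W : Matrix ι κ ℝ) (q : κ → ℝ) (R : ℝ) : Prop :=
  ∀ u : ι → ℝ, (∀ j, (Wᵀ *ᵥ u) j ≤ q j) → ∀ b : ι → ℝ, |u ⬝ᵥ b| ≤ R * ‖b‖

variable {W : Matrix ι κ ℝ} {q : κ → ℝ} {R : ℝ}

/-- Weak duality. -/
theorem dotProduct_le_of_dualFeasible {u : ι → ℝ} (hu : ∀ j, (Wᵀ *ᵥ u) j ≤ q j) {y : κ → ℝ}
    (hy : ∀ j, 0 ≤ y j) : u ⬝ᵥ W *ᵥ y ≤ q ⬝ᵥ y := by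
  rw [dotProduct_mulVec, ← mulVec_transpose]
  exact Finset.sum_le_sum fun j _ => mul_le_mul_of_nonneg_right (hu j) (hy j)

theorem stageValue_le {u : ι → ℝ} (hu : ∀ j, (Wᵀ *ᵥ u) j ≤ q j) {y : κ → ℝ}
    (hy : ∀ j, 0 ≤ y j) : stageValue W q (W *ᵥ y) ≤ q ⬝ᵥ y := by
  refine csInf_le ⟨u ⬝ᵥ W *ᵥ y, ?_⟩ ⟨y, hy, rfl, rfl⟩
  rintro v ⟨y', hy', hWy', rfl⟩
  rw [← hWy']
  exact dotProduct_le_of_dualFeasible hu hy'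

/-- Otherwise Farkas' lemma yields `x` with `Wᵀ x ≥ 0` and `b x < 0`. The ray `u₀ - t x` then stays
dual feasible while its pairing with `b` is unbounded. -/
theorem exists_feasible (hU : ∃ u, ∀ j, (Wᵀ *ᵥ u) j ≤ q j) (hR : DualBound W q R) (b : ι → ℝ) :
    ∃ y : κ → ℝ, (∀ j, 0 ≤ y j) ∧ W *ᵥ y = b := by
  obtain ⟨u₀, hu₀⟩ := hU
  obtain ⟨l, hl, hlb⟩ := farkas Wᵀ b (by
    intro x hx
    by_contra! hbx
    have key : ∀ t : ℝ, 0 ≤ t → u₀ ⬝ᵥ b + t * (-(b ⬝ᵥ x)) ≤ R * ‖b‖ := by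
      intro t ht
      have := hR (u₀ - t • x) (fun j => by
        rw [mulVec_sub, mulVec_smul, Pi.sub_apply, Pi.smul_apply, smul_eq_mul]
        have := mul_nonneg ht (hx j)
        linarith [hu₀ j]) b
      rw [sub_dotProduct, smul_dotProduct, smul_eq_mul, dotProduct_comm x b] at this
      linarith [le_abs_self (u₀ ⬝ᵥ b - t * b ⬝ᵥ x)]
    have h0 := key 0 le_rfl
    have h1 := key ((R * ‖b‖ - u₀ ⬝ᵥ b + 1) / (-(b ⬝ᵥ x))) (by
      apply div_nonneg <;> linarith)
    rw [div_mul_cancel₀ _ (by linarith)] at h1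
    linarith)
  exact ⟨l, hl, by rw [← hlb, vecMul_transpose]⟩

/-- The second stage attains its optimal value. -/
theorem exists_stageValue_eq (hU : ∃ u, ∀ j, (Wᵀ *ᵥ u) j ≤ q j) (hR : DualBound W q R)
    (b : ι → ℝ) : ∃ y : κ → ℝ, (∀ j, 0 ≤ y j) ∧ W *ᵥ y = b ∧ stageValue W q b = q ⬝ᵥ y := by
  let L : (κ → ℝ) →ₗ[ℝ] ℝ × (ι → ℝ) :=
    (dotProductBilin ℝ ℝ q).prod W.mulVecLin
  -- The attainable values are a slice of the closed cone of pairs `(q y, W y)`, so the infimum is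
  -- attained.
  have hset : {v | ∃ y : κ → ℝ, (∀ j, 0 ≤ y j) ∧ W *ᵥ y = b ∧ v = q ⬝ᵥ y} =
      (fun v => (v, b)) ⁻¹' (L '' {x | ∀ i, 0 ≤ x i}) := by
    ext v
    constructor
    · rintro ⟨y, hy, hWy, rfl⟩
      exact ⟨y, hy, Prod.ext rfl hWy⟩
    · rintro ⟨y, hy, hL⟩
      exact ⟨y, hy, congrArg Prod.snd hL, (congrArg Prod.fst hL).symm⟩
  have hcl : IsClosed {v | ∃ y : κ → ℝ, (∀ j, 0 ≤ y j) ∧ W *ᵥ y = b ∧ v = q ⬝ᵥ y} := by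
    rw [hset]
    exact (isClosed_image_nonneg L).preimage (by fun_prop)
  obtain ⟨y₀, hy₀, hWy₀⟩ := exists_feasible hU hR b
  obtain ⟨u, hu⟩ := hU
  obtain ⟨y, hy⟩ := hcl.csInf_mem ⟨_, y₀, hy₀, hWy₀, rfl⟩ ⟨u ⬝ᵥ b, by
    rintro v ⟨y', hy', hWy', rfl⟩
    rw [← hWy']
    exact dotProduct_le_of_dualFeasible hu hy'⟩
  exact ⟨y, hy⟩

theorem dotProduct_le_stageValue (hU : ∃ u, ∀ j, (Wᵀ *ᵥ u) j ≤ q j) (hR : DualBound W q R)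
    {u : ι → ℝ} (hu : ∀ j, (Wᵀ *ᵥ u) j ≤ q j) (b : ι → ℝ) : u ⬝ᵥ b ≤ stageValue W q b := by
  obtain ⟨y, hy, hWy, hv⟩ := exists_stageValue_eq hU hR b
  rw [hv, ← hWy]
  exact dotProduct_le_of_dualFeasible hu hy

/-- Strong duality for the second stage. -/
theorem exists_stageValue_eq_dual (hU : ∃ u, ∀ j, (Wᵀ *ᵥ u) j ≤ q j) (hR : DualBound W q R)
    (b : ι → ℝ) : ∃ u : ι → ℝ, (∀ j, (Wᵀ *ᵥ u) j ≤ q j) ∧ stageValue W q b = u ⬝ᵥ b := by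
  classical
  obtain ⟨y, hy, hWy, hv⟩ := exists_stageValue_eq hU hR b
  obtain ⟨u₀, hu₀⟩ := hU
  obtain ⟨l, u, hl, hlu, hval⟩ := exists_dual_of_optimal (1 : Matrix κ κ ℝ) 0 W b q y
    (by simpa using hy) hWy (fun x hx hWx => by
      rw [← hv, ← hWx]
      exact stageValue_le hu₀ (by simpa using hx))
  refine ⟨u, fun j => ?_, ?_⟩
  · have := congrFun hlu j
    rw [Matrix.vecMul_one, Pi.add_apply] at this
    rw [mulVec_transpose]
    linarith [hl j]
  · rw [hv, ← hval, dotProduct_zero, zero_add]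

/-- Dual feasibility does not involve the right-hand side, so a dual optimum at one right-hand side
is a lower bound at the other. -/
theorem stageValue_sub_le (hU : ∃ u, ∀ j, (Wᵀ *ᵥ u) j ≤ q j) (hR : DualBound W q R)
    (b b' : ι → ℝ) : |stageValue W q b - stageValue W q b'| ≤ R * ‖b - b'‖ := by
  have key : ∀ b b' : ι → ℝ, stageValue W q b - stageValue W q b' ≤ R * ‖b - b'‖ := by
    intro b b'
    obtain ⟨u, hu, hv⟩ := exists_stageValue_eq_dual hU hR b
    have h1 := dotProduct_le_stageValue hU hR hu b'
    have h2 := hR u hu (b - b')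
    rw [dotProduct_sub] at h2
    linarith [le_abs_self (u ⬝ᵥ b - u ⬝ᵥ b')]
  refine abs_le.2 ⟨?_, key b b'⟩
  have := key b' b
  rw [norm_sub_rev] at this
  linarith

theorem stageValue_smul (hU : ∃ u, ∀ j, (Wᵀ *ᵥ u) j ≤ q j) (hR : DualBound W q R)
    {t : ℝ} (ht : 0 ≤ t) (b : ι → ℝ) : stageValue W q (t • b) = t * stageValue W q b := by
  refine le_antisymm ?_ ?_
  · obtain ⟨y, hy, hWy, hv⟩ := exists_stageValue_eq hU hR b
    obtain ⟨u₀, hu₀⟩ := hU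
    rw [hv, ← hWy, ← mulVec_smul, ← smul_eq_mul, ← dotProduct_smul]
    exact stageValue_le hu₀ fun j => mul_nonneg ht (hy j)
  · obtain ⟨u, hu, hv⟩ := exists_stageValue_eq_dual hU hR b
    rw [hv, ← smul_eq_mul, ← dotProduct_smul]
    exact dotProduct_le_stageValue hU hR hu _

theorem continuous_stageValue (hU : ∃ u, ∀ j, (Wᵀ *ᵥ u) j ≤ q j) (hR : DualBound W q R) :
    Continuous (stageValue W q) := by
  refine (LipschitzWith.of_dist_le_mul (K := R.toNNReal) fun b b' => ?_).continuous
  rw [Real.dist_eq, dist_eq_norm]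
  exact (stageValue_sub_le hU hR b b').trans
    (mul_le_mul_of_nonneg_right (Real.le_coe_toNNReal R) (norm_nonneg _))

end SecondStage

/-! ### Optimality conditions for the one-scenario problem. -/

section Saddle

variable {ι κ ν η : Type*} [Fintype ι] [Fintype κ] [Fintype ν] [Fintype η]
  {W : Matrix ι κ ℝ} {q : κ → ℝ} {R : ℝ}

/-- Optimality conditions for the one-scenario problem: necessity. -/
theorem exists_multipliers (hU : ∃ u, ∀ j, (Wᵀ *ᵥ u) j ≤ q j) (hR : DualBound W q R)
    (A : Matrix η ν ℝ) (b : η → ℝ) (c : ν → ℝ) (h : ι → ℝ) (T : Matrix ι ν ℝ) (z : ν → ℝ)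
    (hz : ∀ i, (A *ᵥ z) i ≤ b i)
    (hopt : ∀ w, (∀ i, (A *ᵥ w) i ≤ b i) → c ⬝ᵥ z + stageValue W q (h - T *ᵥ z) ≤
      c ⬝ᵥ w + stageValue W q (h - T *ᵥ w)) :
    ∃ (u : ι → ℝ) (y : κ → ℝ) (l : η → ℝ),
      (∀ j, (Wᵀ *ᵥ u) j ≤ q j) ∧ (∀ j, 0 ≤ y j) ∧ W *ᵥ y = h - T *ᵥ z ∧
      (∀ j, y j ≠ 0 → (Wᵀ *ᵥ u) j = q j) ∧ (∀ i, 0 ≤ l i) ∧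
      c - u ᵥ* T = - (l ᵥ* A) ∧ (∀ i, l i ≠ 0 → (A *ᵥ z) i = b i) := by
  classical
  obtain ⟨y, hy, hWy, hv⟩ := exists_stageValue_eq hU hR (h - T *ᵥ z)
  obtain ⟨u₀, hu₀⟩ := hU
  -- Both stages form one linear program in `(z, y)`: inequalities `-A z ≥ -b`, `y ≥ 0` and
  -- equations `T z + W y = h`.
  obtain ⟨l, u, hl, hlu, hval⟩ := exists_dual_of_optimal
    (Matrix.fromBlocks (-A) 0 0 (1 : Matrix κ κ ℝ)) (Sum.elim (-b) 0) (Matrix.fromCols T W) h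
    (Sum.elim c q) (Sum.elim z y)
    (by
      rw [fromBlocks_mulVec]
      rintro (i | j)
      · simpa [neg_mulVec] using hz i
      · simpa using hy j)
    (by rw [fromCols_mulVec_sumElim, hWy]; abel)
    (by
      intro x hx hTx
      obtain ⟨w, v, rfl⟩ : ∃ (w : ν → ℝ) (v : κ → ℝ), x = Sum.elim w v :=
        ⟨x ∘ Sum.inl, x ∘ Sum.inr, by ext (i | i) <;> rfl⟩
      rw [fromBlocks_mulVec] at hx
      rw [fromCols_mulVec_sumElim] at hTx
      rw [sumElim_dotProduct_sumElim, sumElim_dotProduct_sumElim, ← hv]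
      refine (hopt w fun i => by simpa [neg_mulVec] using hx (Sum.inl i)).trans ?_
      rw [← hTx, add_sub_cancel_left]
      have := stageValue_le hu₀ (fun j => by simpa using hx (Sum.inr j) : ∀ j, 0 ≤ v j)
      linarith)
  obtain ⟨l₁, l₂, rfl⟩ : ∃ (w : η → ℝ) (v : κ → ℝ), l = Sum.elim w v :=
    ⟨l ∘ Sum.inl, l ∘ Sum.inr, by ext (i | i) <;> rfl⟩
  have hl₁ : ∀ i, 0 ≤ l₁ i := fun i => hl (Sum.inl i)
  have hl₂ : ∀ i, 0 ≤ l₂ i := fun i => hl (Sum.inr i)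
  have e1 : c - u ᵥ* T = -(l₁ ᵥ* A) := by
    ext k
    have := congrFun hlu (Sum.inl k)
    simp [vecMul_fromBlocks, vecMul_fromCols, vecMul_neg] at this
    simp [← this]
  have e2 : q = l₂ + u ᵥ* W := by
    ext k
    have := congrFun hlu (Sum.inr k)
    simp [vecMul_fromBlocks, vecMul_fromCols] at this
    simp [← this]
  rw [sumElim_dotProduct_sumElim, sumElim_dotProduct_sumElim] at hval
  simp only [dotProduct_zero, dotProduct_neg, add_zero] at hval
  have hc : c = u ᵥ* T - l₁ ᵥ* A := by
    rw [sub_eq_iff_eq_add] at e1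
    rw [e1]
    abel
  have hh : h = W *ᵥ y + T *ᵥ z := by rw [hWy]; abel
  -- The duality gap is a sum of nonnegative products; its vanishing is complementary slackness.
  have hsum : l₁ ⬝ᵥ (b - A *ᵥ z) + l₂ ⬝ᵥ y = 0 := by
    rw [hc, e2, hh, sub_dotProduct, add_dotProduct, ← dotProduct_mulVec, ← dotProduct_mulVec,
      ← dotProduct_mulVec, dotProduct_add] at hval
    rw [dotProduct_sub]
    linarith
  have n1 : ∀ i ∈ Finset.univ, 0 ≤ l₁ i * (b - A *ᵥ z) i := fun i _ =>
    mul_nonneg (hl₁ i) (sub_nonneg.2 (hz i))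
  have n2 : ∀ j ∈ Finset.univ, 0 ≤ l₂ j * y j := fun j _ => mul_nonneg (hl₂ j) (hy j)
  have s1 : 0 ≤ l₁ ⬝ᵥ (b - A *ᵥ z) := Finset.sum_nonneg n1
  have s2 : 0 ≤ l₂ ⬝ᵥ y := Finset.sum_nonneg n2
  have z1 := (Finset.sum_eq_zero_iff_of_nonneg n1).1 (show l₁ ⬝ᵥ (b - A *ᵥ z) = 0 by linarith)
  have z2 := (Finset.sum_eq_zero_iff_of_nonneg n2).1 (show l₂ ⬝ᵥ y = 0 by linarith)
  have hWu : ∀ j, (Wᵀ *ᵥ u) j = q j - l₂ j := fun j => by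
    rw [mulVec_transpose, e2, Pi.add_apply]; ring
  refine ⟨u, y, l₁, fun j => ?_, hy, hWy, fun j hj => ?_, hl₁, e1, fun i hi => ?_⟩
  · rw [hWu]; linarith [hl₂ j]
  · rw [hWu, (mul_eq_zero.1 (z2 j (Finset.mem_univ _))).resolve_right hj, sub_zero]
  · have := (mul_eq_zero.1 (z1 i (Finset.mem_univ _))).resolve_left hi
    rw [Pi.sub_apply] at this
    linarith

/-- Optimality conditions for the one-scenario problem: sufficiency. -/
theorem optimal_of_multipliers (hU : ∃ u, ∀ j, (Wᵀ *ᵥ u) j ≤ q j) (hR : DualBound W q R)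
    {c : ν → ℝ} {h : ι → ℝ} {T : Matrix ι ν ℝ} {z : ν → ℝ} {u : ι → ℝ} {y : κ → ℝ}
    (hu : ∀ j, (Wᵀ *ᵥ u) j ≤ q j) (hy : ∀ j, 0 ≤ y j) (hWy : W *ᵥ y = h - T *ᵥ z)
    (hcs : ∀ j, y j ≠ 0 → (Wᵀ *ᵥ u) j = q j) {w : ν → ℝ}
    (hzw : (c - u ᵥ* T) ⬝ᵥ z ≤ (c - u ᵥ* T) ⬝ᵥ w) :
    c ⬝ᵥ z + stageValue W q (h - T *ᵥ z) ≤ c ⬝ᵥ w + stageValue W q (h - T *ᵥ w) := by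
  have h1 := dotProduct_le_stageValue hU hR hu (h - T *ᵥ w)
  have h2 : stageValue W q (h - T *ᵥ z) ≤ q ⬝ᵥ y := hWy ▸ stageValue_le hu hy
  have h3 : q ⬝ᵥ y = u ⬝ᵥ (h - T *ᵥ z) := by
    -- By complementary slackness `u` attains the second-stage value at `z`, while at `w` it only
    -- bounds it from below.
    rw [← hWy, dotProduct_mulVec, ← mulVec_transpose]
    refine Finset.sum_congr rfl fun j _ => ?_
    by_cases hj : y j = 0
    · simp [hj]
    · rw [hcs j hj]
  rw [dotProduct_sub, dotProduct_mulVec] at h1 h3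
  rw [sub_dotProduct, sub_dotProduct] at hzw
  linarith

end Saddle

/-! ### Polyhedral cones with prescribed active constraints. -/

section Tight

variable {α X V : Type*} [Fintype α] [AddCommGroup X] [Module ℝ X] [FiniteDimensional ℝ X]
  [NormedAddCommGroup V] [NormedSpace ℝ V]

/-- Linear images of polyhedral cones, given by inequalities some of which are equalities,
are closed. -/
theorem isClosed_image_tightCone (L : X →ₗ[ℝ] V) (M : X →ₗ[ℝ] (α → ℝ)) (s : Set α) :
    IsClosed (L '' {x | (∀ i, 0 ≤ M x i) ∧ ∀ i ∈ s, M x i = 0}) := by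
  classical
  let e := (Module.finBasis ℝ X).equivFun
  let N : X →ₗ[ℝ] (α ⊕ α → ℝ) :=
    { toFun := fun x => Sum.elim (M x) fun i => if i ∈ s then -M x i else 0
      map_add' := fun x y => by
        ext (i | i)
        · simp
        · by_cases hi : i ∈ s <;> simp [hi, add_comm]
      map_smul' := fun t x => by
        ext (i | i)
        · simp
        · by_cases hi : i ∈ s <;> simp [hi] }
  have key : L '' {x | (∀ i, 0 ≤ M x i) ∧ ∀ i ∈ s, M x i = 0} =
      (L ∘ₗ e.symm.toLinearMap) '' {x | ∀ i, 0 ≤ (N ∘ₗ e.symm.toLinearMap) x i} := by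
    ext v
    constructor
    · rintro ⟨x, ⟨hx, hs⟩, rfl⟩
      refine ⟨e x, ?_, by simp⟩
      rintro (i | i)
      · simpa [N] using hx i
      · by_cases hi : i ∈ s <;> simp [N, hi, hs]
    · rintro ⟨x, hx, rfl⟩
      refine ⟨e.symm x, ⟨fun i => hx (Sum.inl i), fun i hi => le_antisymm ?_ (hx (Sum.inl i))⟩, rfl⟩
      simpa [N, hi] using hx (Sum.inr i)
  rw [key]
  exact isClosed_image_polyhedralCone _ _

end Tight

/-! ### Ultrafilter limits, in place of repeated passage to subsequences. -/

theorem exists_tendsto_ultrafilter {ι X : Type*} [TopologicalSpace X] {s : Set X}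
    (hs : IsCompact s) (F : Ultrafilter ι) (f : ι → X) (hf : ∀ k, f k ∈ s) :
    ∃ x ∈ s, Tendsto f F (𝓝 x) :=
  hs.ultrafilter_le_nhds' (F.map f) (Ultrafilter.mem_map.2 (univ_mem' hf))

theorem exists_eventually_eq_ultrafilter {ι X : Type*} [Finite X] (F : Ultrafilter ι)
    (f : ι → X) : ∃ x, ∀ᶠ k in F, f k = x := by
  obtain ⟨x, hx⟩ := Ultrafilter.eq_pure_of_finite (F.map f)
  refine ⟨x, ?_⟩
  have : ({x} : Set X) ∈ F.map f := by rw [hx]; exact Set.mem_singleton x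
  exact Ultrafilter.mem_map.1 this

set_option linter.unusedSectionVars false

/-! ### Lipschitz dependence of the solution on the scenario, for compact `𝒯`. -/

section Lipschitz

variable {ι κ ν η : Type*} [Fintype ι] [Fintype κ] [Fintype ν] [Fintype η]

/-- `z` is an optimal solution of `min {cᵀz + stageValue (h - T z) : A z ≤ b}`. -/
def IsSolution (W : Matrix ι κ ℝ) (q : κ → ℝ) (A : Matrix η ν ℝ) (b : η → ℝ) (c : ν → ℝ)
    (h : ι → ℝ) (T : Matrix ι ν ℝ) (z : ν → ℝ) : Prop :=
  (∀ i, (A *ᵥ z) i ≤ b i) ∧ ∀ w, (∀ i, (A *ᵥ w) i ≤ b i) →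
    c ⬝ᵥ z + stageValue W q (h - T *ᵥ z) ≤ c ⬝ᵥ w + stageValue W q (h - T *ᵥ w)

variable {W : Matrix ι κ ℝ} {q : κ → ℝ} {R : ℝ} {A : Matrix η ν ℝ} {b : η → ℝ} {c : ν → ℝ}

/-- The pair `(z, y)` need not be a limit of approximating solutions: respecting the active sets `s`
and `r` is enough. The multipliers `l` need not converge either, since they enter only through an
inequality at each `k`, which passes to the limit. -/
theorem isSolution_of_tendsto (hU : ∃ u, ∀ j, (Wᵀ *ᵥ u) j ≤ q j) (hR : DualBound W q R)
    {F : Filter ℕ} [NeBot F] {u : ℕ → ι → ℝ} {u₀ : ι → ℝ} (hu₀ : Tendsto u F (𝓝 u₀))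
    {T : ℕ → Matrix ι ν ℝ} {T₀ : Matrix ι ν ℝ} (hT : Tendsto T F (𝓝 T₀))
    {s : Set η} {r : Set κ}
    (hu : ∀ k j, (Wᵀ *ᵥ u k) j ≤ q j)
    (hr : ∀ᶠ k in F, ∀ j ∈ r, (Wᵀ *ᵥ u k) j = q j)
    (hl : ∀ᶠ k in F, ∃ l : η → ℝ, (∀ i, 0 ≤ l i) ∧ c - u k ᵥ* T k = -(l ᵥ* A) ∧
      ∀ i, l i ≠ 0 → i ∈ s)
    {z : ν → ℝ} (hz : ∀ i, (A *ᵥ z) i ≤ b i) (hzs : ∀ i ∈ s, (A *ᵥ z) i = b i)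
    {h : ι → ℝ} {y : κ → ℝ} (hy : ∀ j, 0 ≤ y j) (hyr : ∀ j, y j ≠ 0 → j ∈ r)
    (hWy : W *ᵥ y = h - T₀ *ᵥ z) : IsSolution W q A b c h T₀ z := by
  have hWu : ∀ j, Tendsto (fun k => (Wᵀ *ᵥ u k) j) F (𝓝 ((Wᵀ *ᵥ u₀) j)) := fun j => by
    have hcont : Continuous fun v : ι → ℝ => (Wᵀ *ᵥ v) j :=
      (continuous_apply j).comp (continuous_const.matrix_mulVec continuous_id)
    exact (hcont.tendsto u₀).comp hu₀
  have hcs : ∀ j, y j ≠ 0 → (Wᵀ *ᵥ u₀) j = q j := fun j hj =>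
    tendsto_nhds_unique (hWu j)
      (tendsto_const_nhds.congr' (hr.mono fun k hk => (hk j (hyr j hj)).symm))
  have hlim : ∀ w : ν → ℝ, Tendsto (fun k => (c - u k ᵥ* T k) ⬝ᵥ w) F
      (𝓝 ((c - u₀ ᵥ* T₀) ⬝ᵥ w)) := fun w => by
    have hcont : Continuous fun p : (ι → ℝ) × Matrix ι ν ℝ => (c - p.1 ᵥ* p.2) ⬝ᵥ w :=
      (continuous_const.sub (continuous_fst.matrix_vecMul continuous_snd)).dotProduct
        continuous_const
    exact Tendsto.comp (f := fun k => (u k, T k)) (g := fun p => (c - p.1 ᵥ* p.2) ⬝ᵥ w)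
      (hcont.tendsto (u₀, T₀)) (hu₀.prodMk_nhds hT)
  have hfeas : ∀ j, (Wᵀ *ᵥ u₀) j ≤ q j := fun j =>
    le_of_tendsto (hWu j) (Eventually.of_forall fun k => hu k j)
  refine ⟨hz, fun w hw => optimal_of_multipliers hU hR hfeas hy hWy hcs ?_⟩
  refine le_of_tendsto_of_tendsto (hlim z) (hlim w) (hl.mono ?_)
  rintro k ⟨l, hl0, hlA, hls⟩
  simp only [hlA, neg_dotProduct, neg_le_neg_iff, ← dotProduct_mulVec]
  refine Finset.sum_le_sum fun i _ => ?_
  by_cases hi : l i = 0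
  · simp [hi]
  · rw [hzs i (hls i hi)]
    exact mul_le_mul_of_nonneg_left (hw i) (hl0 i)

theorem eq_zero_of_recession (hZ : Bornology.IsBounded {z : ν → ℝ | ∀ i, (A *ᵥ z) i ≤ b i})
    {z₀ : ν → ℝ} (hz₀ : ∀ i, (A *ᵥ z₀) i ≤ b i) {g : ν → ℝ} (hg : ∀ i, (A *ᵥ g) i ≤ 0) :
    g = 0 := by
  obtain ⟨C, hC⟩ := hZ.exists_norm_le
  by_contra hne
  have hpos : 0 < ‖g‖ := norm_pos_iff.2 hne
  have hmem : ∀ t : ℝ, 0 ≤ t → ‖z₀ + t • g‖ ≤ C := fun t ht => hC _ fun i => by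
    rw [mulVec_add, mulVec_smul, Pi.add_apply, Pi.smul_apply, smul_eq_mul]
    linarith [hz₀ i, mul_nonpos_of_nonneg_of_nonpos ht (hg i)]
  have h0 : 0 ≤ C := (norm_nonneg _).trans (hmem 0 le_rfl)
  -- This multiple of `g` has norm `C + ‖z₀‖ + 1`, so adding it to `z₀` leaves the ball of radius
  -- `C`.
  have ht : 0 ≤ (C + ‖z₀‖ + 1) / ‖g‖ := by positivity
  have h1 := hmem _ ht
  have h2 : ‖((C + ‖z₀‖ + 1) / ‖g‖) • g‖ = C + ‖z₀‖ + 1 := by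
    rw [norm_smul, Real.norm_of_nonneg ht, div_mul_cancel₀ _ hpos.ne']
  have h3 := norm_sub_norm_le (((C + ‖z₀‖ + 1) / ‖g‖) • g) (-z₀)
  rw [sub_neg_eq_add, norm_neg, h2, add_comm _ z₀] at h3
  linarith

theorem isCompact_dualFeasible (hR : DualBound W q R) :
    IsCompact {u : ι → ℝ | ∀ j, (Wᵀ *ᵥ u) j ≤ q j} := by
  classical
  refine Metric.isCompact_of_isClosed_isBounded ?_ ?_
  · simp only [Set.ofPred_forall]
    exact isClosed_iInter fun j => isClosed_le
      ((continuous_apply j).comp (continuous_const.matrix_mulVec continuous_id)) continuous_const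
  · refine isBounded_iff_forall_norm_le.2 ⟨|R|, fun u hu => ?_⟩
    refine (pi_norm_le_iff_of_nonneg (abs_nonneg R)).2 fun i => ?_
    have := hR u hu (Pi.single i 1)
    rw [dotProduct_single_one, Pi.norm_single, norm_one, mul_one] at this
    exact this.trans (le_abs_self R)

/-- The difference of two solutions with prescribed active sets, and the corresponding difference
of second-stage right-hand sides: a closed cone. -/
theorem isClosed_differenceCone (W : Matrix ι κ ℝ) (A : Matrix η ν ℝ) (b : η → ℝ)
    (s s' : Set η) (r r' : Set κ) :
    IsClosed {p : (ι → ℝ) × (ν → ℝ) | ∃ (t : ℝ) (g g' : ν → ℝ) (y y' : κ → ℝ), 0 ≤ t ∧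
      (∀ i, (A *ᵥ g) i ≤ t * b i) ∧ (∀ i ∈ s, (A *ᵥ g) i = t * b i) ∧
      (∀ i, (A *ᵥ g') i ≤ t * b i) ∧ (∀ i ∈ s', (A *ᵥ g') i = t * b i) ∧
      (∀ j, 0 ≤ y j) ∧ (∀ j, y j ≠ 0 → j ∈ r) ∧ (∀ j, 0 ≤ y' j) ∧ (∀ j, y' j ≠ 0 → j ∈ r') ∧
      p = (W *ᵥ y' - W *ᵥ y, g - g')} := by
  -- `M` lists `t`, the slacks of `g` and `g'`, and `y`, `y'`; the tight coordinates are those in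
  -- `s` and `s'` and those outside `r` and `r'`.
  let M : (ℝ × (ν → ℝ) × (ν → ℝ) × (κ → ℝ) × (κ → ℝ)) →ₗ[ℝ] (Unit ⊕ η ⊕ η ⊕ κ ⊕ κ → ℝ) :=
    { toFun := fun x => Sum.elim (fun _ => x.1) (Sum.elim (x.1 • b - A *ᵥ x.2.1)
        (Sum.elim (x.1 • b - A *ᵥ x.2.2.1) (Sum.elim x.2.2.2.1 x.2.2.2.2)))
      map_add' := fun x x' => by
        ext (i | i | i | i | i) <;> simp [mulVec_add] <;> ring
      map_smul' := fun t x => by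
        ext (i | i | i | i | i) <;> simp [mulVec_smul] <;> ring }
  let L : (ℝ × (ν → ℝ) × (ν → ℝ) × (κ → ℝ) × (κ → ℝ)) →ₗ[ℝ] (ι → ℝ) × (ν → ℝ) :=
    { toFun := fun x => (W *ᵥ x.2.2.2.2 - W *ᵥ x.2.2.2.1, x.2.1 - x.2.2.1)
      map_add' := fun x x' => by
        ext i <;> simp [mulVec_add] <;> ring
      map_smul' := fun t x => by
        ext i <;> simp [mulVec_smul] <;> ring }
  refine (congrArg IsClosed (Set.ext fun p => ?_)).mpr (isClosed_image_tightCone L M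
    {a | Sum.elim (fun _ => False) (Sum.elim (· ∈ s) (Sum.elim (· ∈ s')
      (Sum.elim (· ∉ r) (· ∉ r')))) a})
  constructor
  · rintro ⟨t, g, g', y, y', ht, h1, h2, h3, h4, h5, h6, h7, h8, rfl⟩
    refine ⟨(t, g, g', y, y'), ⟨?_, ?_⟩, rfl⟩
    · rintro (i | i | i | i | i)
      · exact ht
      · simpa [M] using h1 i
      · simpa [M] using h3 i
      · exact h5 i
      · exact h7 i
    · rintro (i | i | i | i | i) hi
      · exact hi.elim
      · simpa [M, sub_eq_zero] using (h2 i hi).symm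
      · simpa [M, sub_eq_zero] using (h4 i hi).symm
      · exact not_not.1 fun h => hi (h6 i h)
      · exact not_not.1 fun h => hi (h8 i h)
  · rintro ⟨⟨t, g, g', y, y'⟩, ⟨h, he⟩, rfl⟩
    refine ⟨t, g, g', y, y', h (Sum.inl ()), fun i => ?_, fun i hi => ?_, fun i => ?_,
      fun i hi => ?_, fun j => h (Sum.inr (Sum.inr (Sum.inr (Sum.inl j)))), fun j hj => ?_,
      fun j => h (Sum.inr (Sum.inr (Sum.inr (Sum.inr j)))), fun j hj => ?_, rfl⟩
    · simpa [M] using h (Sum.inr (Sum.inl i))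
    · simpa [M, sub_eq_zero, eq_comm] using he (Sum.inr (Sum.inl i)) hi
    · simpa [M] using h (Sum.inr (Sum.inr (Sum.inl i)))
    · simpa [M, sub_eq_zero, eq_comm] using he (Sum.inr (Sum.inr (Sum.inl i))) hi
    · exact not_not.1 fun h => hj (he (Sum.inr (Sum.inr (Sum.inr (Sum.inl j)))) h)
    · exact not_not.1 fun h => hj (he (Sum.inr (Sum.inr (Sum.inr (Sum.inr j)))) h)

/-- If the one-scenario problem has at most one solution for every right-hand side and every
technology matrix in a compact set, then its solution is Lipschitz in the scenario. -/
theorem exists_lipschitz_solution (hU : ∃ u, ∀ j, (Wᵀ *ᵥ u) j ≤ q j) (hR : DualBound W q R)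
    (hZ : Bornology.IsBounded {z : ν → ℝ | ∀ i, (A *ᵥ z) i ≤ b i})
    {𝒯 : Set (Matrix ι ν ℝ)} (h𝒯 : IsCompact 𝒯)
    (huniq : ∀ h, ∀ T ∈ 𝒯, ∀ z z', IsSolution W q A b c h T z → IsSolution W q A b c h T z' →
      z = z') :
    ∃ K : ℝ, 0 ≤ K ∧ ∀ (h h' : ι → ℝ), ∀ T ∈ 𝒯, ∀ T' ∈ 𝒯, ∀ z z' : ν → ℝ, ∀ ρ : ℝ,
      IsSolution W q A b c h T z → IsSolution W q A b c h' T' z' →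
      (∀ i, |h i - h' i| ≤ ρ) → (∀ i j, |T i j - T' i j| ≤ ρ) → 0 ≤ ρ → ‖z - z'‖ ≤ K * ρ := by
  by_contra hcon
  push Not at hcon
  choose h h' T hT T' hT' z z' ρ hz hz' hh hTT hρ hlt using
    fun k : ℕ => hcon k (Nat.cast_nonneg k)
  choose u y l hu hy hWy hcs hl hcl hlA using
    fun k => exists_multipliers hU hR A b c (h k) (T k) (z k) (hz k).1 (hz k).2
  choose u' y' l' hu' hy' hWy' hcs' hl' hcl' hlA' using
    fun k => exists_multipliers hU hR A b c (h' k) (T' k) (z' k) (hz' k).1 (hz' k).2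
  let F := hyperfilter ℕ
  have hF : (F : Filter ℕ) ≤ atTop := Nat.hyperfilter_le_atTop
  have hpos : ∀ k, 0 < ‖z k - z' k‖ := fun k =>
    (mul_nonneg (Nat.cast_nonneg k) (hρ k)).trans_lt (hlt k)
  -- limits along the ultrafilter
  obtain ⟨T₀, hT₀, hTlim⟩ := exists_tendsto_ultrafilter h𝒯 F T hT
  obtain ⟨u₀, -, hulim⟩ := exists_tendsto_ultrafilter (isCompact_dualFeasible hR) F u hu
  obtain ⟨u₀', -, hulim'⟩ := exists_tendsto_ultrafilter (isCompact_dualFeasible hR) F u' hu'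
  let d : ℕ → ν → ℝ := fun k => ‖z k - z' k‖⁻¹ • (z k - z' k)
  obtain ⟨d₀, hd₀, hdlim⟩ := exists_tendsto_ultrafilter (isCompact_sphere (0 : ν → ℝ) 1) F d
    (fun k => by
      rw [mem_sphere_zero_iff_norm, norm_smul, norm_inv, norm_norm, inv_mul_cancel₀ (hpos k).ne'])
  obtain ⟨s, hs⟩ := exists_eventually_eq_ultrafilter F fun k => {i | l k i ≠ 0}
  obtain ⟨s', hs'⟩ := exists_eventually_eq_ultrafilter F fun k => {i | l' k i ≠ 0}
  obtain ⟨r, hr⟩ := exists_eventually_eq_ultrafilter F fun k => {j | y k j ≠ 0}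
  obtain ⟨r', hr'⟩ := exists_eventually_eq_ultrafilter F fun k => {j | y' k j ≠ 0}
  -- relative perturbations tend to zero
  have hρlim : Tendsto (fun k => ‖z k - z' k‖⁻¹ * ρ k) F (𝓝 0) := by
    refine squeeze_zero' (.of_forall fun k => mul_nonneg (inv_nonneg.2 (hpos k).le) (hρ k)) ?_
      (tendsto_inv_atTop_nhds_zero_nat.mono_left hF : Tendsto (fun k : ℕ => (k : ℝ)⁻¹) F (𝓝 0))
    filter_upwards [hF (eventually_gt_atTop 0)] with k hk
    have hk' : (0 : ℝ) < k := Nat.cast_pos.2 hk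
    rw [inv_mul_eq_div, div_le_iff₀ (hpos k), inv_mul_eq_div, le_div_iff₀ hk', mul_comm]
    exact (hlt k).le
  obtain ⟨C, hC⟩ := hZ.exists_norm_le
  -- Since `Z` is bounded, the absolute perturbations vanish as well, so `T` and `T'` have the same
  -- limit.
  have hρ0 : Tendsto ρ F (𝓝 0) := by
    have : Tendsto (fun k => (2 * C) * (‖z k - z' k‖⁻¹ * ρ k)) F (𝓝 0) := by
      simpa using hρlim.const_mul (2 * C)
    refine squeeze_zero (fun k => hρ k) (fun k => ?_) this
    have h1 : ‖z k - z' k‖ ≤ 2 * C := by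
      linarith [norm_sub_le (z k) (z' k), hC _ (hz k).1, hC _ (hz' k).1]
    have h2 : ρ k = ‖z k - z' k‖ * (‖z k - z' k‖⁻¹ * ρ k) := by
      rw [mul_inv_cancel_left₀ (hpos k).ne']
    conv_lhs => rw [h2]
    exact mul_le_mul_of_nonneg_right h1 (mul_nonneg (inv_nonneg.2 (hpos k).le) (hρ k))
  have hTlim' : Tendsto T' F (𝓝 T₀) := by
    refine tendsto_pi_nhds.2 fun i => tendsto_pi_nhds.2 fun j => ?_
    have h1 : Tendsto (fun k => T k i j) F (𝓝 (T₀ i j)) :=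
      tendsto_pi_nhds.1 (tendsto_pi_nhds.1 hTlim i) j
    have h2 : Tendsto (fun k => T k i j - T' k i j) F (𝓝 0) :=
      squeeze_zero_norm (fun k => hTT k i j) hρ0
    simpa using h1.sub h2
  have hwlim : Tendsto (fun k => ‖z k - z' k‖⁻¹ • (W *ᵥ y' k - W *ᵥ y k)) F
      (𝓝 (T₀ *ᵥ d₀)) := by
    have h1 : Tendsto (fun k => T k *ᵥ d k) F (𝓝 (T₀ *ᵥ d₀)) :=
      Tendsto.comp (f := fun k => (T k, d k)) (g := fun p => p.1 *ᵥ p.2)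
        ((continuous_fst.matrix_mulVec continuous_snd).tendsto (T₀, d₀))
        (hTlim.prodMk_nhds hdlim)
    have h2 : Tendsto (fun k => ‖z k - z' k‖⁻¹ • (W *ᵥ y' k - W *ᵥ y k) - T k *ᵥ d k) F
        (𝓝 0) := by
      refine tendsto_pi_nhds.2 fun i => squeeze_zero_norm (a := fun k =>
        (Fintype.card ν * C + 1) * (‖z k - z' k‖⁻¹ * ρ k)) (fun k => ?_) (by
          simpa using hρlim.const_mul (Fintype.card ν * C + 1))
      -- Subtracting the two second-stage equations leaves only perturbation terms, of order `ρ k`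
      -- because `z' k` is bounded.
      have e : ‖z k - z' k‖⁻¹ • (W *ᵥ y' k - W *ᵥ y k) - T k *ᵥ d k =
          ‖z k - z' k‖⁻¹ • ((T k - T' k) *ᵥ z' k - (h k - h' k)) := by
        rw [hWy, hWy', mulVec_smul, ← smul_sub, mulVec_sub, sub_mulVec]
        congr 1
        abel
      have e1 : ‖((T k - T' k) *ᵥ z' k) i‖ ≤ Fintype.card ν * C * ρ k := by
        calc ‖((T k - T' k) *ᵥ z' k) i‖ ≤ ∑ j, ‖(T k i j - T' k i j) * z' k j‖ :=
              norm_sum_le _ _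
          _ ≤ ∑ _j : ν, ρ k * C := Finset.sum_le_sum fun j _ => by
              rw [norm_mul]
              exact mul_le_mul (hTT k i j) ((norm_le_pi_norm _ j).trans (hC _ (hz' k).1))
                (norm_nonneg _) (hρ k)
          _ = Fintype.card ν * C * ρ k := by simp; ring
      rw [e, Pi.smul_apply, norm_smul, norm_inv, norm_norm, mul_left_comm]
      refine mul_le_mul_of_nonneg_left ?_ (inv_nonneg.2 (hpos k).le)
      rw [Pi.sub_apply]
      have e2 : ‖(h k - h' k) i‖ ≤ ρ k := hh k i
      linarith [norm_sub_le (((T k - T' k) *ᵥ z' k) i) ((h k - h' k) i)]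
    simpa using h2.add h1
  -- the limit lies in the cone of differences
  have hmem := (isClosed_differenceCone W A b s s' r r').mem_of_tendsto
    (hwlim.prodMk_nhds hdlim) (by
      filter_upwards [hs, hs', hr, hr'] with k hs hs' hr hr'
      have hp := inv_nonneg.2 (hpos k).le
      refine ⟨‖z k - z' k‖⁻¹, ‖z k - z' k‖⁻¹ • z k, ‖z k - z' k‖⁻¹ • z' k,
        ‖z k - z' k‖⁻¹ • y k, ‖z k - z' k‖⁻¹ • y' k, hp, ?_, ?_, ?_, ?_, ?_, ?_, ?_, ?_, ?_⟩
      · intro i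
        rw [mulVec_smul]
        exact mul_le_mul_of_nonneg_left ((hz k).1 i) hp
      · intro i hi
        rw [← hs] at hi
        rw [mulVec_smul, ← hlA k i hi]
        rfl
      · intro i
        rw [mulVec_smul]
        exact mul_le_mul_of_nonneg_left ((hz' k).1 i) hp
      · intro i hi
        rw [← hs'] at hi
        rw [mulVec_smul, ← hlA' k i hi]
        rfl
      · exact fun j => mul_nonneg hp (hy k j)
      · intro j hj
        rw [← hr]
        exact right_ne_zero_of_mul hj
      · exact fun j => mul_nonneg hp (hy' k j)
      · intro j hj
        rw [← hr']
        exact right_ne_zero_of_mul hj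
      · rw [mulVec_smul, mulVec_smul, ← smul_sub, ← smul_sub])
  obtain ⟨t, g, g', v, v', ht, hg, hgs, hg', hgs', hv, hvr, hv', hvr', heq⟩ := hmem
  have hw : T₀ *ᵥ d₀ = W *ᵥ v' - W *ᵥ v := congrArg Prod.fst heq
  have hd : d₀ = g - g' := congrArg Prod.snd heq
  have hgne : g ≠ g' := by
    rintro rfl
    rw [sub_self] at hd
    simp [hd] at hd₀
  -- For `t = 0` both `g` and `g'` are recession directions of a bounded polyhedron, hence zero.
  rcases ht.eq_or_lt with rfl | ht
  · refine hgne ?_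
    rw [eq_zero_of_recession hZ (hz 0).1 (g := g) (by simpa using hg),
      eq_zero_of_recession hZ (hz 0).1 (g := g') (by simpa using hg')]
  have hti := inv_nonneg.2 ht.le
  have sc : ∀ x a : ℝ, x ≤ t * a → t⁻¹ * x ≤ a := fun x a h => by
    rw [inv_mul_eq_div, div_le_iff₀ ht, mul_comm]; exact h
  have sc' : ∀ x a : ℝ, x = t * a → t⁻¹ * x = a := fun x a h => by
    rw [h, inv_mul_cancel_left₀ ht.ne']
  -- The right-hand side is chosen to make `v / t` feasible for `g / t`; `T₀ d₀ = W v' - W v` makes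
  -- `v' / t` feasible for `g' / t` in the same scenario.
  have hsol : IsSolution W q A b c (W *ᵥ (t⁻¹ • v) + T₀ *ᵥ (t⁻¹ • g)) T₀ (t⁻¹ • g) := by
    refine isSolution_of_tendsto hU hR hulim hTlim hu (r := r) (s := s) (y := t⁻¹ • v) ?_ ?_
      (fun i => ?_) (fun i hi => ?_) (fun j => mul_nonneg hti (hv j))
      (fun j hj => hvr j (right_ne_zero_of_mul hj)) (by abel)
    · filter_upwards [hr] with k hk j hj
      exact hcs k j (by rwa [← hk] at hj)
    · filter_upwards [hs] with k hk
      exact ⟨l k, hl k, hcl k, fun i hi => by rw [← hk]; exact hi⟩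
    · rw [mulVec_smul]; exact sc _ _ (hg i)
    · rw [mulVec_smul]; exact sc' _ _ (hgs i hi)
  have hsol' : IsSolution W q A b c (W *ᵥ (t⁻¹ • v) + T₀ *ᵥ (t⁻¹ • g)) T₀ (t⁻¹ • g') := by
    refine isSolution_of_tendsto hU hR hulim' hTlim' hu' (r := r') (s := s') (y := t⁻¹ • v') ?_ ?_
      (fun i => ?_) (fun i hi => ?_) (fun j => mul_nonneg hti (hv' j))
      (fun j hj => hvr' j (right_ne_zero_of_mul hj)) ?_
    · filter_upwards [hr'] with k hk j hj
      exact hcs' k j (by rwa [← hk] at hj)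
    · filter_upwards [hs'] with k hk
      exact ⟨l' k, hl' k, hcl' k, fun i hi => by rw [← hk]; exact hi⟩
    · rw [mulVec_smul]; exact sc _ _ (hg' i)
    · rw [mulVec_smul]; exact sc' _ _ (hgs' i hi)
    · rw [hd, mulVec_sub, sub_eq_iff_eq_add] at hw
      simp only [mulVec_smul, hw, smul_sub, smul_add]
      abel
  exact hgne (smul_right_injective _ (inv_ne_zero ht.ne') (huniq _ T₀ hT₀ _ _ hsol hsol'))

end Lipschitz

/-! ### Norm estimates and coordinates of scenarios. -/

theorem exists_dualBound {m r : ℕ} {W : Matrix (Fin m) (Fin r) ℝ} {q : Fin r → ℝ}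
    (hb : Bornology.IsBounded {u : E m | ∀ j, (Wᵀ *ᵥ u.ofLp) j ≤ q j}) :
    ∃ R, 0 ≤ R ∧ DualBound W q R := by
  obtain ⟨C, hC⟩ := hb.exists_norm_le
  refine ⟨m * |C|, by positivity, fun u hu b => ?_⟩
  have hu' : ‖(WithLp.toLp 2 u : E m)‖ ≤ C := hC _ hu
  calc |u ⬝ᵥ b| ≤ ∑ i, |u i * b i| := Finset.abs_sum_le_sum_abs _ _
    _ ≤ ∑ _i : Fin m, |C| * ‖b‖ := Finset.sum_le_sum fun i _ => by
        rw [abs_mul]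
        refine mul_le_mul ?_ (norm_le_pi_norm b i) (abs_nonneg _) (abs_nonneg _)
        exact (PiLp.norm_apply_le (WithLp.toLp 2 u : E m) i).trans (hu'.trans (le_abs_self C))
    _ = m * |C| * ‖b‖ := by simp; ring

theorem norm_mulVec_le {m n : ℕ} {T : Matrix (Fin m) (Fin n) ℝ} {M : ℝ} (hM : 0 ≤ M)
    (hT : ∀ i j, |T i j| ≤ M) (v : Fin n → ℝ) : ‖T *ᵥ v‖ ≤ n * M * ‖v‖ := by
  refine (pi_norm_le_iff_of_nonneg (by positivity)).2 fun i => ?_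
  calc ‖(T *ᵥ v) i‖ ≤ ∑ j, ‖T i j * v j‖ :=
        norm_sum_le Finset.univ fun j => T i j * v j
    _ ≤ ∑ _j : Fin n, M * ‖v‖ := Finset.sum_le_sum fun j _ => by
        rw [norm_mul]
        exact mul_le_mul (hT i j) (norm_le_pi_norm v j) (norm_nonneg _) hM
    _ = n * M * ‖v‖ := by simp; ring

theorem abs_dotProduct_le {n : ℕ} (c v : Fin n → ℝ) : |c ⬝ᵥ v| ≤ n * ‖c‖ * ‖v‖ := by
  calc |c ⬝ᵥ v| ≤ ∑ j, |c j * v j| := Finset.abs_sum_le_sum_abs _ _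
    _ ≤ ∑ _j : Fin n, ‖c‖ * ‖v‖ := Finset.sum_le_sum fun j _ => by
        rw [abs_mul]
        exact mul_le_mul (norm_le_pi_norm c j) (norm_le_pi_norm v j) (abs_nonneg _)
          (norm_nonneg _)
    _ = n * ‖c‖ * ‖v‖ := by simp; ring

section Scenarios

variable {m n : ℕ}

/-- The scenario with right-hand side `h` and technology matrix `T`. -/
def mkScenario (h : Fin m → ℝ) (T : Matrix (Fin m) (Fin n) ℝ) : Scenario m n :=
  WithLp.toLp 2 (Sum.elim h fun p => T p.1 p.2)

@[simp] theorem rhs_mkScenario (h : Fin m → ℝ) (T : Matrix (Fin m) (Fin n) ℝ) :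
    rhs (mkScenario h T) = h := rfl

@[simp] theorem tech_mkScenario (h : Fin m → ℝ) (T : Matrix (Fin m) (Fin n) ℝ) :
    tech (mkScenario h T) = T := rfl

theorem abs_rhs_sub_le (ξ ξ' : Scenario m n) (i : Fin m) : |rhs ξ i - rhs ξ' i| ≤ ‖ξ - ξ'‖ :=
  PiLp.norm_apply_le (ξ - ξ') (Sum.inl i)

theorem abs_tech_sub_le (ξ ξ' : Scenario m n) (i : Fin m) (j : Fin n) :
    |tech ξ i j - tech ξ' i j| ≤ ‖ξ - ξ'‖ :=
  PiLp.norm_apply_le (ξ - ξ') (Sum.inr (i, j))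

theorem norm_rhs_le (ξ : Scenario m n) : ‖rhs ξ‖ ≤ ‖ξ‖ :=
  (pi_norm_le_iff_of_nonneg (norm_nonneg _)).2 fun i => PiLp.norm_apply_le ξ (Sum.inl i)

theorem abs_tech_le (ξ : Scenario m n) (i : Fin m) (j : Fin n) : |tech ξ i j| ≤ ‖ξ‖ :=
  PiLp.norm_apply_le ξ (Sum.inr (i, j))

theorem continuous_rhs : Continuous (rhs : Scenario m n → Fin m → ℝ) :=
  continuous_pi fun _ => PiLp.continuous_apply 2 _ _

theorem continuous_tech : Continuous (tech : Scenario m n → Matrix (Fin m) (Fin n) ℝ) :=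
  continuous_pi fun _ => continuous_pi fun _ => PiLp.continuous_apply 2 _ _

end Scenarios

/-! ### Cost bounds and regularity of the one-scenario solution map. -/

namespace Program

variable {n m r : ℕ} {P : Program n m r} {c : Fin n → ℝ} {R : ℝ}

theorem recourse_eq (z : E n) (ξ : Scenario m n) :
    P.recourse z ξ = stageValue P.W P.q (rhs ξ - tech ξ *ᵥ z.ofLp) := rfl

theorem G_eq (hf : ∀ z, P.f z = c ⬝ᵥ z.ofLp) (z : E n) (ξ : Scenario m n) :
    P.G z ξ = c ⬝ᵥ z.ofLp + stageValue P.W P.q (rhs ξ - tech ξ *ᵥ z.ofLp) := by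
  rw [G, hf, recourse_eq]

theorem zD_mem {ξ : Scenario m n} (h : (P.oneScenarioArgmin ξ).Nonempty) :
    P.zD ξ ∈ P.oneScenarioArgmin ξ := by
  rw [zD, dif_pos h]
  exact h.some_mem

theorem continuous_G (hf : ∀ z, P.f z = c ⬝ᵥ z.ofLp)
    (hU : ∃ u, ∀ j, (P.Wᵀ *ᵥ u) j ≤ P.q j) (hR : DualBound P.W P.q R) :
    Continuous fun p : E n × Scenario m n => P.G p.1 p.2 := by
  simp only [G_eq hf]
  have h1 : Continuous fun p : E n × Scenario m n => p.1.ofLp :=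
    (PiLp.continuous_ofLp 2 _).comp continuous_fst
  exact (continuous_const.dotProduct h1).add ((continuous_stageValue hU hR).comp
    ((continuous_rhs.comp continuous_snd).sub ((continuous_tech.comp continuous_snd).matrix_mulVec h1)))

/-- Costs of feasible decisions grow at most linearly in the scenario. -/
theorem exists_abs_G_le (hf : ∀ z, P.f z = c ⬝ᵥ z.ofLp) (hZ : Bornology.IsBounded P.Z)
    (hU : ∃ u, ∀ j, (P.Wᵀ *ᵥ u) j ≤ P.q j) (hR0 : 0 ≤ R) (hR : DualBound P.W P.q R) :
    ∃ C, 0 ≤ C ∧ ∀ z ∈ P.Z, ∀ ξ, |P.G z ξ| ≤ C * (1 + ‖ξ‖) := by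
  obtain ⟨B, hB⟩ := hZ.exists_norm_le
  set φ₀ := |stageValue P.W P.q 0|
  refine ⟨n * ‖c‖ * |B| + φ₀ + R * (1 + n * |B|), by positivity, fun z hz ξ => ?_⟩
  have hzB : ‖z.ofLp‖ ≤ |B| := (pi_norm_le_iff_of_nonneg (abs_nonneg _)).2 fun i =>
    (PiLp.norm_apply_le z i).trans ((hB z hz).trans (le_abs_self B))
  have h1 : |c ⬝ᵥ z.ofLp| ≤ n * ‖c‖ * |B| := (abs_dotProduct_le c z.ofLp).trans (by gcongr)
  have h2 : ‖rhs ξ - tech ξ *ᵥ z.ofLp‖ ≤ (1 + n * |B|) * ‖ξ‖ := by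
    have h3 : ‖tech ξ *ᵥ z.ofLp‖ ≤ n * ‖ξ‖ * |B| :=
      (norm_mulVec_le (norm_nonneg ξ) (abs_tech_le ξ) z.ofLp).trans (by gcongr)
    linarith [norm_sub_le (rhs ξ) (tech ξ *ᵥ z.ofLp), norm_rhs_le ξ]
  have h4 := stageValue_sub_le hU hR (rhs ξ - tech ξ *ᵥ z.ofLp) 0
  rw [sub_zero] at h4
  have h5 := abs_sub_abs_le_abs_sub (stageValue P.W P.q (rhs ξ - tech ξ *ᵥ z.ofLp))
    (stageValue P.W P.q 0)
  have h6 := mul_le_mul_of_nonneg_left h2 hR0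
  have h7 := abs_add_le (c ⬝ᵥ z.ofLp) (stageValue P.W P.q (rhs ξ - tech ξ *ᵥ z.ofLp))
  have h8 : 0 ≤ (n * ‖c‖ * |B| + φ₀) * ‖ξ‖ := by positivity
  have h9 : 0 ≤ R * (1 + n * |B|) := by positivity
  rw [G_eq hf]
  linarith

/-- If every scenario has a unique optimal first-stage decision, then the decision is the same
for all scenarios. -/
theorem zD_eq_of_forall_unique (hf : ∀ z, P.f z = c ⬝ᵥ z.ofLp) (hZ : Bornology.IsBounded P.Z)
    (hU : ∃ u, ∀ j, (P.Wᵀ *ᵥ u) j ≤ P.q j) (hR : DualBound P.W P.q R)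
    (huniq : ∀ ξ : Scenario m n, ∃! z, z ∈ P.oneScenarioArgmin ξ) (ξ ξ' : Scenario m n) :
    P.zD ξ = P.zD ξ' := by
  have hmem : ∀ ξ, P.zD ξ ∈ P.oneScenarioArgmin ξ := fun ξ => zD_mem (huniq ξ).exists
  -- If zero is the only dual feasible point, the recourse vanishes and the scenario plays no role.
  by_cases h0 : ∀ u, (∀ j, (P.Wᵀ *ᵥ u) j ≤ P.q j) → u = 0
  · have hG : ∀ z ξ, P.G z ξ = c ⬝ᵥ z.ofLp := fun z ξ => by
      obtain ⟨u, hu, hv⟩ := exists_stageValue_eq_dual hU hR (rhs ξ - tech ξ *ᵥ z.ofLp)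
      rw [G_eq hf, hv, h0 u hu, zero_dotProduct, add_zero]
    refine (huniq ξ').unique ⟨(hmem ξ).1, fun w hw => ?_⟩ (hmem ξ')
    have := (hmem ξ).2 w hw
    rwa [hG, hG] at this ⊢
  · push Not at h0
    obtain ⟨a, ha, hane⟩ := h0
    obtain ⟨B, hB⟩ := hZ.exists_norm_le
    set σ := stageValue P.W P.q a with hσ
    have hσpos : 0 < σ := by
      refine lt_of_lt_of_le ?_ (dotProduct_le_stageValue hU hR ha a)
      exact (Finset.sum_nonneg fun i _ => mul_self_nonneg (a i)).lt_of_ne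
        fun h => hane (dotProduct_self_eq_zero.1 h.symm)
    -- For `h = t a` and `T = a (c / σ)ᵀ` the residual is `(t - c z / σ) a`. This `t` makes the
    -- factor nonnegative on `Z`, so by homogeneity the recourse is `t σ - c z` and cancels the
    -- first-stage cost.
    set t := n * ‖c‖ * |B| / σ
    have hconst : ∀ z ∈ P.Z, P.G z (mkScenario (t • a) (vecMulVec a (σ⁻¹ • c))) = t * σ := by
      intro z hz
      have hzB : ‖z.ofLp‖ ≤ |B| := (pi_norm_le_iff_of_nonneg (abs_nonneg _)).2 fun i =>
        (PiLp.norm_apply_le z i).trans ((hB z hz).trans (le_abs_self B))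
      have h1 : c ⬝ᵥ z.ofLp ≤ n * ‖c‖ * |B| :=
        (le_abs_self _).trans ((abs_dotProduct_le c z.ofLp).trans (by gcongr))
      have h2 : t • a - vecMulVec a (σ⁻¹ • c) *ᵥ z.ofLp = (t - σ⁻¹ * (c ⬝ᵥ z.ofLp)) • a := by
        ext i
        rw [vecMulVec_mulVec, smul_dotProduct]
        simp
        ring
      have h3 : 0 ≤ t - σ⁻¹ * (c ⬝ᵥ z.ofLp) := by
        rw [inv_mul_eq_div, ← sub_div]
        exact div_nonneg (by linarith) hσpos.le
      rw [G_eq hf, rhs_mkScenario, tech_mkScenario, h2, stageValue_smul hU hR h3, ← hσ]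
      field_simp
      ring
    have hopt : ∀ z ∈ P.Z, z ∈ P.oneScenarioArgmin
        (mkScenario (t • a) (vecMulVec a (σ⁻¹ • c))) := fun z hz =>
      ⟨hz, fun w hw => by rw [hconst z hz, hconst w hw]⟩
    exact (huniq _).unique (hopt _ (hmem ξ).1) (hopt _ (hmem ξ').1)

/-- The one-scenario solution map is continuous on the admissible scenarios, and the cost of
its values is Lipschitz in the scenario. -/
theorem exists_lipschitz_zD (hf : ∀ z, P.f z = c ⬝ᵥ z.ofLp) (hZ : IsPolyhedral P.Z)
    (hZb : Bornology.IsBounded P.Z) (hU : ∃ u, ∀ j, (P.Wᵀ *ᵥ u) j ≤ P.q j) (hR0 : 0 ≤ R)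
    (hR : DualBound P.W P.q R) {𝒯 : Set (Matrix (Fin m) (Fin n) ℝ)}
    (h𝒯 : IsCompact 𝒯 ∨ 𝒯 = Set.univ)
    (huniq : ∀ ξ : Scenario m n, tech ξ ∈ 𝒯 → ∃! z, z ∈ P.oneScenarioArgmin ξ) :
    ∃ K : ℝ, 0 ≤ K ∧ ContinuousOn P.zD {ξ | tech ξ ∈ 𝒯} ∧
      ∀ ξ₁ ξ₂ ξ : Scenario m n, tech ξ₁ ∈ 𝒯 → tech ξ₂ ∈ 𝒯 → tech ξ ∈ 𝒯 →
        |P.G (P.zD ξ₁) ξ - P.G (P.zD ξ₂) ξ| ≤ K * ‖ξ₁ - ξ₂‖ := by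
  rcases h𝒯 with h𝒯 | rfl
  swap
  · have hconst := zD_eq_of_forall_unique hf hZb hU hR fun ξ => huniq ξ (Set.mem_univ _)
    refine ⟨0, le_rfl, ?_, fun ξ₁ ξ₂ ξ _ _ _ => by simp [hconst ξ₁ ξ₂]⟩
    exact continuousOn_const.congr fun ξ _ => hconst ξ 0
  obtain ⟨k, A, b, hA⟩ := hZ
  have hbdd : Bornology.IsBounded {z : Fin n → ℝ | ∀ i, (A *ᵥ z) i ≤ b i} := by
    obtain ⟨B, hB⟩ := hZb.exists_norm_le
    refine isBounded_iff_forall_norm_le.2 ⟨|B|, fun z hz => ?_⟩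
    have hz' : (WithLp.toLp 2 z : E n) ∈ P.Z := by rw [hA]; exact hz
    exact (pi_norm_le_iff_of_nonneg (abs_nonneg _)).2 fun i =>
      (PiLp.norm_apply_le (WithLp.toLp 2 z : E n) i).trans ((hB _ hz').trans (le_abs_self B))
  have hsol : ∀ (ξ : Scenario m n) (z : E n), z ∈ P.oneScenarioArgmin ξ ↔
      IsSolution P.W P.q A b c (rhs ξ) (tech ξ) z.ofLp := by
    intro ξ z
    simp only [oneScenarioArgmin, IsSolution, G_eq hf, hA, Set.mem_ofPred_eq]
    exact and_congr_right fun _ =>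
      ⟨fun h w hw => h (WithLp.toLp 2 w) hw, fun h w hw => h w.ofLp hw⟩
  obtain ⟨K, hK0, hK⟩ := exists_lipschitz_solution (A := A) (b := b) (c := c) hU hR hbdd h𝒯
    (fun h T hT z z' hz hz' => by
      have := (huniq (mkScenario h T) hT).unique
        ((hsol _ (WithLp.toLp 2 z)).2 hz) ((hsol _ (WithLp.toLp 2 z')).2 hz')
      exact congrArg WithLp.ofLp this)
  have hlip : ∀ ξ₁ ξ₂ : Scenario m n, tech ξ₁ ∈ 𝒯 → tech ξ₂ ∈ 𝒯 →
      ‖(P.zD ξ₁).ofLp - (P.zD ξ₂).ofLp‖ ≤ K * ‖ξ₁ - ξ₂‖ := fun ξ₁ ξ₂ h₁ h₂ =>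
    hK _ _ _ h₁ _ h₂ _ _ _ ((hsol _ _).1 (zD_mem (huniq _ h₁).exists))
      ((hsol _ _).1 (zD_mem (huniq _ h₂).exists)) (abs_rhs_sub_le ξ₁ ξ₂) (abs_tech_sub_le ξ₁ ξ₂)
      (norm_nonneg _)
  -- Bounded technology matrices make the cost Lipschitz in the decision, uniformly over admissible
  -- scenarios.
  obtain ⟨M, hM⟩ : ∃ M : ℝ, ∀ T ∈ 𝒯, ∀ i j, |T i j| ≤ |M| := by
    obtain ⟨M, hM⟩ := (show IsCompact (X := Fin m → Fin n → ℝ) 𝒯 from h𝒯).isBounded.exists_norm_le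
    exact ⟨M, fun T hT i j => ((norm_le_pi_norm (T i) j).trans
      (norm_le_pi_norm (show Fin m → Fin n → ℝ from T) i)).trans ((hM T hT).trans (le_abs_self M))⟩
  refine ⟨(n * ‖c‖ + R * (n * |M|)) * K, by positivity, ?_, fun ξ₁ ξ₂ ξ h₁ h₂ h => ?_⟩
  · have hc : ContinuousOn (fun ξ => (P.zD ξ).ofLp) {ξ | tech ξ ∈ 𝒯} := by
      refine LipschitzOnWith.continuousOn (K := K.toNNReal) ?_
      refine LipschitzOnWith.of_dist_le_mul fun ξ₁ h₁ ξ₂ h₂ => ?_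
      rw [dist_eq_norm, dist_eq_norm, Real.coe_toNNReal K hK0]
      exact hlip ξ₁ ξ₂ h₁ h₂
    exact (PiLp.continuous_toLp 2 _).comp_continuousOn hc
  · set z₁ := (P.zD ξ₁).ofLp
    set z₂ := (P.zD ξ₂).ofLp
    have e1 : |c ⬝ᵥ z₁ - c ⬝ᵥ z₂| ≤ n * ‖c‖ * ‖z₁ - z₂‖ := by
      rw [← dotProduct_sub]
      exact abs_dotProduct_le c _
    have e2 : |stageValue P.W P.q (rhs ξ - tech ξ *ᵥ z₁) -
        stageValue P.W P.q (rhs ξ - tech ξ *ᵥ z₂)| ≤ R * (n * |M| * ‖z₁ - z₂‖) := by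
      refine (stageValue_sub_le hU hR _ _).trans (mul_le_mul_of_nonneg_left ?_ hR0)
      rw [sub_sub_sub_cancel_left, ← mulVec_sub, norm_sub_rev z₁]
      exact norm_mulVec_le (abs_nonneg M) (hM _ h) _
    have e3 := abs_add_le (c ⬝ᵥ z₁ - c ⬝ᵥ z₂) (stageValue P.W P.q (rhs ξ - tech ξ *ᵥ z₁) -
        stageValue P.W P.q (rhs ξ - tech ξ *ᵥ z₂))
    have e4 : 0 ≤ n * ‖c‖ + R * (n * |M|) := by positivity
    have e5 := mul_le_mul_of_nonneg_left (hlip ξ₁ ξ₂ h₁ h₂) e4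
    rw [G_eq hf, G_eq hf, add_sub_add_comm]
    linarith

end Program

/-! ### A uniform strong law of large numbers and convergence of minimizers. -/

section UniformLaw

variable {Y Θ : Type*} [MeasurableSpace Y] [MetricSpace Θ] [CompactSpace Θ]

/-- A map into `C(Θ, ℝ)` is measurable as soon as all its evaluations are. -/
theorem measurable_of_measurable_eval [MeasurableSpace C(Θ, ℝ)] [BorelSpace C(Θ, ℝ)]
    {F : Y → C(Θ, ℝ)} (hF : ∀ θ, Measurable fun y => F y θ) : Measurable F := by
  have hball : ∀ (g : C(Θ, ℝ)) (ε : ℝ), 0 ≤ ε → MeasurableSet (F ⁻¹' Metric.closedBall g ε) := by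
    intro g ε hε
    obtain ⟨t, htc, htd⟩ := TopologicalSpace.exists_countable_dense Θ
    -- By continuity the sup-norm condition need only be tested on a countable dense set.
    have : F ⁻¹' Metric.closedBall g ε = ⋂ θ ∈ t, {y | dist (F y θ) (g θ) ≤ ε} := by
      ext y
      simp only [Set.mem_preimage, Metric.mem_closedBall, Set.mem_iInter, Set.mem_ofPred_eq,
        ContinuousMap.dist_le hε]
      refine ⟨fun h θ _ => h θ, fun h θ => ?_⟩
      have hcl : IsClosed {θ | dist (F y θ) (g θ) ≤ ε} :=
        isClosed_le ((F y).continuous.dist g.continuous) continuous_const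
      exact hcl.closure_subset_iff.2 (fun θ hθ => h θ hθ) (htd θ)
    rw [this]
    exact MeasurableSet.biInter htc fun θ _ =>
      measurableSet_le ((hF θ).dist measurable_const) measurable_const
  refine measurable_of_isOpen fun s hs => ?_
  have hε : ∀ g : C(Θ, ℝ), ∃ ε : ℝ, 0 < ε ∧ (g ∈ s → Metric.closedBall g ε ⊆ s) := by
    intro g
    by_cases hg : g ∈ s
    · obtain ⟨ε, hε, h⟩ := Metric.nhds_basis_closedBall.mem_iff.1 (hs.mem_nhds hg)
      exact ⟨ε, hε, fun _ => h⟩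
    · exact ⟨1, one_pos, fun h => absurd h hg⟩
  choose ε hε0 hε using hε
  -- Since `C(Θ, ℝ)` is second countable, an open set is a countable union of closed balls.
  obtain ⟨t, hts, htc, hst⟩ := TopologicalSpace.countable_cover_nhdsWithin
    (f := fun g => Metric.closedBall g (ε g)) (s := s)
    (fun g _ => mem_nhdsWithin_of_mem_nhds (Metric.closedBall_mem_nhds g (hε0 g)))
  have : s = ⋃ g ∈ t, Metric.closedBall g (ε g) :=
    hst.antisymm (Set.iUnion₂_subset fun g hg => hε g (hts hg))
  rw [this, Set.preimage_iUnion₂]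
  exact MeasurableSet.biUnion htc fun g _ => hball g _ (hε0 g).le

/-- **Uniform strong law of large numbers** over a compact parameter space. -/
theorem ae_tendstoUniformly_average {ν : Measure Y} {f : Θ → Y → ℝ}
    (hcont : ∀ y, Continuous fun θ => f θ y) (hmeas : ∀ θ, Measurable (f θ)) {bound : Y → ℝ}
    (hb : Integrable bound ν) (hfb : ∀ θ y, |f θ y| ≤ bound y)
    {Ω : Type*} [MeasurableSpace Ω] {μ : Measure Ω} {D : ℕ → Ω → Y}
    (hD : ∀ i, Measurable (D i)) (hind : iIndepFun D μ) (hν : ∀ i, μ.map (D i) = ν) :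
    (Continuous fun θ => ∫ y, f θ y ∂ν) ∧ ∀ᵐ ω ∂μ, TendstoUniformly
      (fun (N : ℕ) θ => (1 / (N : ℝ)) * ∑ i ∈ Finset.range N, f θ (D i ω))
      (fun θ => ∫ y, f θ y ∂ν) atTop := by
  borelize C(Θ, ℝ)
  -- The Banach-valued strong law applies to `F`, and norm convergence in `C(Θ, ℝ)` is uniform
  -- convergence.
  let F : Y → C(Θ, ℝ) := fun y => ⟨fun θ => f θ y, hcont y⟩
  have hF : Measurable F := measurable_of_measurable_eval hmeas
  have hFi : Integrable F ν := ⟨hF.aestronglyMeasurable,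
    ContinuousMap.hasFiniteIntegral_of_bound F bound hb.2 (.of_forall fun y θ => hfb θ y)⟩
  have hval : ∀ θ, (∫ y, F y ∂ν) θ = ∫ y, f θ y ∂ν := fun θ =>
    ContinuousMap.integral_apply hFi θ
  refine ⟨?_, ?_⟩
  · simp only [← hval]
    exact (∫ y, F y ∂ν).continuous
  have hlaw := strong_law_ae (μ := μ) (fun i ω => F (D i ω))
    ((show Integrable F (μ.map (D 0)) by rwa [hν 0]).comp_measurable (hD 0))
    (fun i j hij => (hind.indepFun hij).comp hF hF)
    (fun i => (IdentDistrib.mk (hD i).aemeasurable (hD 0).aemeasurable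
      ((hν i).trans (hν 0).symm)).comp hF)
  have hexp : ∫ ω, F (D 0 ω) ∂μ = ∫ y, F y ∂ν := by
    rw [← hν 0, integral_map (hD 0).aemeasurable hF.aestronglyMeasurable]
  rw [hexp] at hlaw
  filter_upwards [hlaw] with ω hω
  have hu := ContinuousMap.tendsto_iff_tendstoUniformly.1 hω
  have e1 : (fun (N : ℕ) θ => (1 / (N : ℝ)) * ∑ i ∈ Finset.range N, f θ (D i ω)) =
      fun (N : ℕ) θ => ((N : ℝ)⁻¹ • ∑ i ∈ Finset.range N, F (D i ω)) θ := by
    funext N θ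
    simp [F]
  have e2 : (fun θ => ∫ y, f θ y ∂ν) = ⇑(∫ y, F y ∂ν) := funext fun θ => (hval θ).symm
  rw [e1, e2]
  exact hu

end UniformLaw

/-- Minimizers of uniformly convergent functions are asymptotically optimal for the limit. -/
theorem tendsto_of_approx_argmin {Θ : Type*} {s : Set Θ} {g : ℕ → Θ → ℝ} {f : Θ → ℝ}
    (hu : TendstoUniformlyOn g f atTop s) {θ₀ : Θ} (hθ₀ : θ₀ ∈ s) (hmin : ∀ θ ∈ s, f θ₀ ≤ f θ)
    {θ : ℕ → Θ} (hθ : ∀ᶠ N in atTop, θ N ∈ s ∧ ∀ η ∈ s, g N (θ N) ≤ g N η) :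
    Tendsto (fun N => f (θ N)) atTop (𝓝 (f θ₀)) := by
  rw [Metric.tendsto_atTop']
  intro ε hε
  obtain ⟨N₀, hN₀⟩ := eventually_atTop.1
    ((Metric.tendstoUniformlyOn_iff.1 hu (ε / 2) (half_pos hε)).and hθ)
  refine ⟨N₀, fun N hN => ?_⟩
  obtain ⟨h1, h2, h3⟩ := hN₀ N hN.le
  have e1 := abs_lt.1 (h1 _ h2)
  have e2 := abs_lt.1 (h1 _ hθ₀)
  rw [Real.dist_eq, abs_lt]
  constructor <;> linarith [hmin _ h2, h3 _ hθ₀, e1.1, e1.2, e2.1, e2.2]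

/-! ### Measurability and optimality of policies. -/

namespace Program

variable {n m r s : ℕ} {P : Program n m r} {c : Fin n → ℝ} {R : ℝ} {𝒳 : Set (E s)}

/-- Continuity of `zD` is known only on admissible scenarios, so the composition factors through
that subtype. -/
theorem measurable_zD_comp {𝒯 : Set (Matrix (Fin m) (Fin n) ℝ)}
    (hcont : ContinuousOn P.zD {ξ | tech ξ ∈ 𝒯}) {ψ : 𝒳 → Scenario m n} (hψ : Measurable ψ)
    (hψ𝒯 : ∀ x, tech (ψ x) ∈ 𝒯) : Measurable fun x => P.zD (ψ x) := by
  have h1 : Measurable fun x => (⟨ψ x, hψ𝒯 x⟩ : {ξ : Scenario m n | tech ξ ∈ 𝒯}) :=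
    hψ.subtype_mk
  have h2 : Measurable (Set.domRestrict {ξ : Scenario m n | tech ξ ∈ 𝒯} P.zD) :=
    (continuousOn_iff_continuous_domRestrict.1 hcont).measurable
  exact Measurable.comp (g := Set.domRestrict {ξ : Scenario m n | tech ξ ∈ 𝒯} P.zD)
    (f := fun x => ⟨ψ x, hψ𝒯 x⟩) h2 h1

theorem measurable_G_comp (hf : ∀ z, P.f z = c ⬝ᵥ z.ofLp)
    (hU : ∃ u, ∀ j, (P.Wᵀ *ᵥ u) j ≤ P.q j) (hR : DualBound P.W P.q R) {π : 𝒳 → E n}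
    (hπ : Measurable π) : Measurable fun y : 𝒳 × Scenario m n => P.G (π y.1) y.2 :=
  (continuous_G hf hU hR).measurable.comp ((hπ.comp measurable_fst).prodMk measurable_snd)

/-- Solving the problem of an optimal scenario is an optimal policy. -/
theorem performance_zD_le {ν : Measure (𝒳 × Scenario m n)} [IsProbabilityMeasure ν]
    (hint : ∀ π ∈ P.policies 𝒳, Integrable (fun y : 𝒳 × Scenario m n => P.G (π y.1) y.2) ν)
    {ξs : 𝒳 → Scenario m n} (hπ₀ : (fun x => P.zD (ξs x)) ∈ P.policies 𝒳)
    (hopt : ∀ᵐ x ∂ν.fst, P.IsOptimalScenario (ν.condKernel x) (ξs x)) {π : 𝒳 → E n}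
    (hπ : π ∈ P.policies 𝒳) :
    P.performance ν (fun x => P.zD (ξs x)) ≤ P.performance ν π := by
  have h0 := hint _ hπ₀
  have h1 := hint _ hπ
  -- Disintegrating `ν` over the features reduces the comparison to the conditional problem at
  -- almost every `x`.
  rw [performance, performance, ← Measure.integral_condKernel h0,
    ← Measure.integral_condKernel h1]
  refine integral_mono_ae h0.integral_condKernel h1.integral_condKernel ?_
  filter_upwards [hopt] with x hx
  exact (hx.2 (zD_mem hx.1)).2 _ (hπ.2 x)

end Program

end TwoStage

/-! ### The main theorem. -/

theorem theorem4 {n m r : ℕ} (P : TwoStage.Program n m r) (c : Fin n → ℝ)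
    (𝒯 : Set (Matrix (Fin m) (Fin n) ℝ))
    -- the set of technology matrices is compact, or there is no restriction on them at all
    (h𝒯 : IsCompact 𝒯 ∨ 𝒯 = Set.univ)
    -- the first stage is linear
    (hf : ∀ z, P.f z = c ⬝ᵥ z.ofLp)
    (hZ : TwoStage.IsPolyhedral P.Z)
    -- the feasible set is non-empty and bounded
    (hZne : P.Z.Nonempty) (hZbdd : Bornology.IsBounded P.Z)
    -- the dual feasible set of the second stage is non-empty and bounded
    (hUne : P.dualFeasible.Nonempty) (hUbdd : Bornology.IsBounded P.dualFeasible)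
    -- every one-scenario problem has a unique optimal solution
    (huniq : ∀ ξ : TwoStage.Scenario m n, TwoStage.tech ξ ∈ 𝒯 → ∃! z, z ∈ P.oneScenarioArgmin ξ) :
    ∃ K : ℝ, 0 ≤ K ∧
      ∀ (s p : ℕ) (𝒳 : Set (TwoStage.E s))
        -- the joint distribution of features and uncertainty
        (ν : Measure (𝒳 × TwoStage.Scenario m n)) [IsProbabilityMeasure ν],
        (∀ᵐ y ∂ν, TwoStage.tech y.2 ∈ 𝒯) →
        Integrable (fun y => y.2) ν →
      -- the i.i.d. data process
      ∀ (Ω : Type*) [MeasurableSpace Ω] (μ : Measure Ω) [IsProbabilityMeasure μ]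
        (D : ℕ → Ω → 𝒳 × TwoStage.Scenario m n),
        (∀ i, Measurable (D i)) → iIndepFun D μ → (∀ i, μ.map (D i) = ν) →
      -- the parameter set and the forecast function
      ∀ (Θ : Set (TwoStage.E p)) (Ψ : TwoStage.E p → 𝒳 → TwoStage.Scenario m n),
        Θ.Nonempty →
        (∀ θ ∈ Θ, ∀ x, TwoStage.tech (Ψ θ x) ∈ 𝒯) →
        ((IsCompact Θ ∧ (∀ x, ContinuousOn (fun θ => Ψ θ x) Θ) ∧ ∀ θ ∈ Θ, Continuous (Ψ θ)) ∨
          (Θ.Finite ∧ ∀ θ ∈ Θ, Measurable (Ψ θ))) →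
      -- the optimal-scenario map
      ∀ (ξs : 𝒳 → TwoStage.Scenario m n),
        Measurable ξs → (∀ x, TwoStage.tech (ξs x) ∈ 𝒯) →
        (∀ᵐ x ∂ν.fst, P.IsOptimalScenario (ν.condKernel x) (ξs x)) →
      ∀ δ : ℝ, 0 ≤ δ → (∃ θh ∈ Θ, ∀ x, ‖Ψ θh x - ξs x‖ ≤ δ) →
      -- the learned parameters
      ∀ θN : ℕ → Ω → TwoStage.E p,
        (∀ᵐ ω ∂μ, ∀ N, 1 ≤ N → θN N ω ∈ P.learningArgmin Θ Ψ (fun i => D i ω) N) →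
      ∃ L : ℝ,
        (∀ᵐ ω ∂μ, Tendsto
          (fun N => P.performance ν (fun x => P.zD (Ψ (θN N ω) x))) atTop (𝓝 L)) ∧
        ∃ π₀ ∈ P.policies 𝒳,
          (∀ π ∈ P.policies 𝒳, P.performance ν π₀ ≤ P.performance ν π) ∧
          L - P.performance ν π₀ ≤ K * δ := by
  have hU : ∃ u, ∀ j, (P.Wᵀ *ᵥ u) j ≤ P.q j := hUne.imp' WithLp.ofLp fun u hu => hu
  obtain ⟨R, hR0, hR⟩ := TwoStage.exists_dualBound hUbdd
  obtain ⟨K, hK0, hcont, hK⟩ :=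
    TwoStage.Program.exists_lipschitz_zD hf hZ hZbdd hU hR0 hR h𝒯 huniq
  obtain ⟨C, hC0, hC⟩ := TwoStage.Program.exists_abs_G_le hf hZbdd hU hR0 hR
  refine ⟨K, hK0, ?_⟩
  intro s p 𝒳 ν _ hν𝒯 hνint Ω _ μ _ D hD hind hlaw Θ Ψ hΘne hΨ𝒯 hΨ ξs hξs hξs𝒯 hopt δ hδ
    ⟨θh, hθh, hθhδ⟩ θN hθN
  -- Both alternatives reduce to compact `Θ`, with continuity in `θ` and measurability in `x`.
  obtain ⟨hΘ, hΨc, hΨm⟩ : IsCompact Θ ∧ (∀ x, ContinuousOn (fun θ => Ψ θ x) Θ) ∧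
      ∀ θ ∈ Θ, Measurable (Ψ θ) := by
    rcases hΨ with ⟨h1, h2, h3⟩ | ⟨h1, h2⟩
    · exact ⟨h1, h2, fun θ hθ => (h3 θ hθ).measurable⟩
    · exact ⟨h1.isCompact, fun x => h1.continuousOn _, h2⟩
  have hzD : ∀ ξ, TwoStage.tech ξ ∈ 𝒯 → P.zD ξ ∈ P.Z := fun ξ h =>
    (TwoStage.Program.zD_mem (huniq ξ h).exists).1
  have hbound : Integrable (fun y : 𝒳 × TwoStage.Scenario m n => C * (1 + ‖y.2‖)) ν :=
    ((integrable_const 1).add hνint.norm).const_mul C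
  have hint : ∀ π ∈ P.policies 𝒳,
      Integrable (fun y : 𝒳 × TwoStage.Scenario m n => P.G (π y.1) y.2) ν := fun π hπ =>
    hbound.mono' (TwoStage.Program.measurable_G_comp hf hU hR hπ.1).aestronglyMeasurable
      (.of_forall fun y => hC _ (hπ.2 y.1) y.2)
  have hpol : ∀ ψ : 𝒳 → TwoStage.Scenario m n, Measurable ψ →
      (∀ x, TwoStage.tech (ψ x) ∈ 𝒯) → (fun x => P.zD (ψ x)) ∈ P.policies 𝒳 := fun ψ hψ h =>
    ⟨TwoStage.Program.measurable_zD_comp hcont hψ h, fun x => hzD _ (h x)⟩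
  have : CompactSpace Θ := isCompact_iff_compactSpace.1 hΘ
  obtain ⟨hperf, hunif⟩ := TwoStage.ae_tendstoUniformly_average (Θ := Θ) (ν := ν)
    (f := fun θ y => P.G (P.zD (Ψ θ y.1)) y.2)
    (fun y => by
      have h1 : Continuous fun θ : Θ => P.zD (Ψ θ y.1) :=
        (hcont.comp (hΨc y.1) fun θ hθ => hΨ𝒯 θ hθ y.1).domRestrict
      exact (TwoStage.Program.continuous_G hf hU hR).comp (h1.prodMk continuous_const))
    (fun θ => TwoStage.Program.measurable_G_comp hf hU hR (hpol _ (hΨm θ θ.2) (hΨ𝒯 θ θ.2)).1)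
    hbound (fun θ y => hC _ (hzD _ (hΨ𝒯 θ θ.2 y.1)) y.2) hD hind hlaw
  have hperf' : ContinuousOn (fun θ => P.performance ν fun x => P.zD (Ψ θ x)) Θ :=
    continuousOn_iff_continuous_domRestrict.2 hperf
  -- The limit is the least true performance over `Θ`, which is why it does not depend on the data.
  obtain ⟨θ₀, hθ₀, hmin⟩ := hΘ.exists_isMinOn hΘne hperf'
  refine ⟨P.performance ν fun x => P.zD (Ψ θ₀ x), ?_, fun x => P.zD (ξs x), hpol _ hξs hξs𝒯,
    fun π hπ => TwoStage.Program.performance_zD_le hint (hpol _ hξs hξs𝒯) hopt hπ, ?_⟩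
  · filter_upwards [hunif, hθN] with ω hω hθω
    refine TwoStage.tendsto_of_approx_argmin (s := Θ)
      (g := fun N θ => P.empiricalCost Ψ (fun i => D i ω) N θ)
      (f := fun θ => P.performance ν fun x => P.zD (Ψ θ x)) ?_ hθ₀ hmin
      (eventually_atTop.2 ⟨1, fun N hN => hθω N hN⟩)
    rw [tendstoUniformlyOn_iff_tendstoUniformly_comp_coe]
    exact hω
  · have h1 := hint _ (hpol _ (hΨm θh hθh) (hΨ𝒯 θh hθh))
    have h2 := hint _ (hpol _ hξs hξs𝒯)
    have h3 : (∫ y, P.G (P.zD (Ψ θh y.1)) y.2 ∂ν) - ∫ y, P.G (P.zD (ξs y.1)) y.2 ∂ν ≤ K * δ := by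
      rw [← integral_sub h1 h2]
      have h4 := integral_mono_ae (h1.sub h2) (integrable_const (K * δ)) (by
        filter_upwards [hν𝒯] with y hy
        exact (le_abs_self _).trans ((hK _ _ _ (hΨ𝒯 θh hθh y.1) (hξs𝒯 y.1) hy).trans
          (mul_le_mul_of_nonneg_left (hθhδ y.1) hK0)))
      simpa using h4
    exact (sub_le_sub_right (hmin hθh) _).trans h3
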